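/- Let $\mathbb{S}^3\times\mathbb{R}$ be the Riemannian product of the unit 3-sphere and the real line, let $\partial_t$ be the unit vector field tangent to the $\mathbb{R}$-direction, and let $\theta\in(0,\pi/2)$ be a constant. Let $F\colon M\to\mathbb{S}^3\times\mathbb{R}$ be a smooth immersion of a smooth surface $M$ (a 2-dimensional manifold without boundary) such that at every point of $M$ the vector $\partial_t$ makes the angle $\theta$ with the normal plane of $M$ in $\mathbb{S}^3\times\mathbb{R}$; that is, at every point $\partial_t=\sin\theta\,T+\cos\theta\,\xi$ with a unit tangent vector $T$ and a unit normal vector $\xi$ of $M$. If the mean curvature vector field $\vec H$ of $M$ is parallel with respect to the normal connection, $\nabla^{\perp}\vec H=0$, then $\vec H=0$ on $M$, that is, $M$ is a minimal surface in $\mathbb{S}^3\times\mathbb{R}$. -/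

import Mathlib

open Metric
open scoped Manifold ContDiff RealInnerProductSpace

noncomputable section

namespace S3R

/-- The Riemannian product manifold `S³(1) × ℝ`: the unit sphere of Euclidean `ℝ⁴` times the real
line, with the product smooth structure. Its metric is the one induced by the embedding `incl`. -/
abbrev Space : Type := sphere (0 : EuclideanSpace ℝ (Fin 4)) 1 × ℝ

/-- Euclidean 5-space, as the orthogonal sum of `ℝ⁴` and `ℝ`. -/
abbrev E5 : Type := WithLp 2 (EuclideanSpace ℝ (Fin 4) × ℝ)

/-- The standard isometric embedding of `S³ × ℝ` in Euclidean 5-space. -/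
def incl (q : Space) : E5 := WithLp.toLp 2 ((q.1 : EuclideanSpace ℝ (Fin 4)), q.2)

/-- The tangent space of `S³ × ℝ` at `q`, as a subspace of Euclidean 5-space: the orthogonal
complement of the normal vector `(q.1, 0)`. -/
def ambientTangent (q : Space) : Submodule ℝ E5 :=
  (ℝ ∙ (WithLp.toLp 2 ((q.1 : EuclideanSpace ℝ (Fin 4)), (0 : ℝ)) : E5))ᗮ

/-- The unit vector field `∂t` tangent to the `ℝ`-direction. -/
def dt : E5 := WithLp.toLp 2 ((0 : EuclideanSpace ℝ (Fin 4)), (1 : ℝ))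

variable {M : Type*} [TopologicalSpace M] [ChartedSpace (EuclideanSpace ℝ (Fin 2)) M]

/-- A smooth immersion of the surface `M` in `S³ × ℝ`. -/
structure IsSmoothImmersion (F : M → Space) : Prop where
  contMDiff : ContMDiff (𝓡 2) ((𝓡 3).prod 𝓘(ℝ, ℝ)) ∞ F
  injective_mfderiv : ∀ p : M,
    Function.Injective (mfderiv (𝓡 2) ((𝓡 3).prod 𝓘(ℝ, ℝ)) F p)

/-- The differential at `p` of a map `V : M → E5` (the immersion, or a vector field along it). -/
def diff (V : M → E5) (p : M) : EuclideanSpace ℝ (Fin 2) →L[ℝ] E5 :=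
  mfderiv (𝓡 2) 𝓘(ℝ, E5) V p

/-- The tangent plane `dF (T_p M)` of the surface. -/
def tangentPlane (F : M → Space) (p : M) : Submodule ℝ E5 :=
  LinearMap.range (diff (fun q => incl (F q)) p).toLinearMap

/-- The normal plane of the surface in `S³ × ℝ` at `p`. -/
def normalPlane (F : M → Space) (p : M) : Submodule ℝ E5 :=
  ambientTangent (F p) ⊓ (tangentPlane F p)ᗮ

/-- At `p`, the direction `∂t` makes the angle `θ` with the normal plane:
`∂t = sin θ T + cos θ ξ` with a unit tangent vector `T` and a unit normal vector `ξ`. -/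
def HasAngleAt (F : M → Space) (θ : ℝ) (p : M) : Prop :=
  ∃ T ∈ tangentPlane F p, ∃ ξ ∈ normalPlane F p,
    ‖T‖ = 1 ∧ ‖ξ‖ = 1 ∧ dt = Real.sin θ • T + Real.cos θ • ξ

/-- The Levi-Civita connection of `S³ × ℝ` along `F`: the covariant derivative at `p`, in the
direction `u ∈ T_p M`, of a vector field `V` along `F`. It is the tangential part of the
derivative in Euclidean 5-space. -/
def ambientCov (F : M → Space) (V : M → E5) (p : M) (u : EuclideanSpace ℝ (Fin 2)) : E5 :=
  (ambientTangent (F p)).starProjection (diff V p u)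

/-- For a normal vector field `V` of the surface, the derivative of `V` at `p` in the direction `u`
with respect to the normal connection. -/
def normalCov (F : M → Space) (V : M → E5) (p : M) (u : EuclideanSpace ℝ (Fin 2)) : E5 :=
  (normalPlane F p).starProjection (ambientCov F V p u)

/-- The vector field along `F`, defined near `p`, which is the image under `dF` of the coordinate
vector field with constant components `v` in the preferred chart at `p`. -/
def coordField (F : M → Space) (p : M) (v : EuclideanSpace ℝ (Fin 2)) (q : M) : E5 :=
  fderiv ℝ (fun y => incl (F ((extChartAt (𝓡 2) p).symm y))) (extChartAt (𝓡 2) p q) v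

/-- The second fundamental form of the surface at `p` (Gauss formula): the normal part of
the ambient covariant derivative in the direction `u` of an extension of `v`. The value does not
depend on the extension. -/
def secondFundamentalForm (F : M → Space) (p : M) (u v : EuclideanSpace ℝ (Fin 2)) : E5 :=
  (normalPlane F p).starProjection (ambientCov F (coordField F p v) p u)

/-- The Gram matrix at `p` of the induced metric in the standard basis of `T_p M`. -/
def gram (F : M → Space) (p : M) : Matrix (Fin 2) (Fin 2) ℝ := Matrix.of fun i j =>
  ⟪diff (fun q => incl (F q)) p (EuclideanSpace.single i (1 : ℝ)),
    diff (fun q => incl (F q)) p (EuclideanSpace.single j (1 : ℝ))⟫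

/-- The mean curvature vector: half of the trace of the second fundamental form with respect to
the induced metric. -/
def meanCurvature (F : M → Space) (p : M) : E5 :=
  (1 / 2 : ℝ) • ∑ i, ∑ j, (gram F p)⁻¹ i j •
    secondFundamentalForm F p (EuclideanSpace.single i (1 : ℝ)) (EuclideanSpace.single j (1 : ℝ))

/-- The mean curvature vector field is parallel with respect to the normal connection. -/
def HasParallelMeanCurvature (F : M → Space) : Prop :=
  ∀ (p : M) (u : EuclideanSpace ℝ (Fin 2)), normalCov F (meanCurvature F) p u = 0

end S3R

end

/-! Work locally in Euclidean 5-space with k = `dt`, σ = sin θ, c = cos θ. The angle condition says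
that the tangential part of k has constant length σ, so it gives a canonical unit tangent field T =
c W + σ k with W unit and orthogonal to k. Complete this to an orthonormal frame N, W, S, η, k: N is
the normal of the cylinder S³ × ℝ, S the other tangent direction, η and ξ = -σ W + c k the normal
directions (`exists_isAdaptedFrame`).

Since k is constant, it forces most of the connection. With t and s the fields mapped to T and S,
the bracket [t, s] has no t-component (`exists_lieBracket`), and four functions remain: a = ⟪η, tW⟫,
b = ⟪η, sW⟫, l = ⟪S, sW⟫, e = ⟪η, sS⟫. Commuting derivatives of W and S gives one Gauss and two
Codazzi equations (`codazzi`). The mean curvature is 2H = σ l ξ + m η with m = c a + e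
(`two_smul_eq`), and parallelism of H reads t l = -m a, s l = -m b, t m = σ² l a, s m = σ² l b.

This system is overdetermined (`eq_zero_of_codazzi_of_parallel`). The Gauss equation becomes a² + b²
= 1 + l², and commuting t and s on m gives l² b = 0. Where l ≠ 0, b vanishes, hence e vanishes,
hence l a = 0, which contradicts a² = 1 + l². So l = 0; then m a = m b = 0 with a² + b² = 1, so m =
0 and H = 0.

The rest passes from the manifold to a fixed chart. The main point is that the normal part of the
second derivative is independent of the chart (`inner_secondFundamentalForm`). -/

/-! ### Calculus of derivatives along vector fields -/

section DirDeriv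
variable {V G : Type*} [NormedAddCommGroup V] [NormedSpace ℝ V]
  [NormedAddCommGroup G] [NormedSpace ℝ G]

/-- The derivative of `g` along the vector field `X`. -/
noncomputable def dirDeriv (X : V → V) (g : V → G) (y : V) : G := fderiv ℝ g y (X y)

theorem contDiffOn_dirDeriv {U : Set V} (hU : IsOpen U) {X : V → V} {g : V → G}
    (hX : ContDiffOn ℝ ∞ X U) (hg : ContDiffOn ℝ ∞ g U) : ContDiffOn ℝ ∞ (dirDeriv X g) U :=
  (hg.fderiv_of_isOpen hU (by simp)).clm_apply hX

theorem ContDiffOn.differentiableAt_of_isOpen {U : Set V} (hU : IsOpen U) {g : V → G}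
    (hg : ContDiffOn ℝ ∞ g U) {y : V} (hy : y ∈ U) : DifferentiableAt ℝ g y :=
  (hg.contDiffAt (hU.mem_nhds hy)).differentiableAt (by simp)

theorem dirDeriv_congr {U : Set V} (hU : IsOpen U) {X : V → V} {g h : V → G}
    (hgh : ∀ y ∈ U, g y = h y) {y : V} (hy : y ∈ U) : dirDeriv X g y = dirDeriv X h y := by
  have : g =ᶠ[nhds y] h := Filter.eventuallyEq_of_mem (hU.mem_nhds hy) hgh
  simp [dirDeriv, this.fderiv_eq]

theorem dirDeriv_const (X : V → V) (v : G) (y : V) : dirDeriv X (fun _ => v) y = 0 := by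
  simp [dirDeriv]

theorem dirDeriv_add {X : V → V} {g h : V → G} {y : V} (hg : DifferentiableAt ℝ g y)
    (hh : DifferentiableAt ℝ h y) :
    dirDeriv X (fun z => g z + h z) y = dirDeriv X g y + dirDeriv X h y := by
  simp [dirDeriv, fderiv_fun_add hg hh]

theorem dirDeriv_sub {X : V → V} {g h : V → G} {y : V} (hg : DifferentiableAt ℝ g y)
    (hh : DifferentiableAt ℝ h y) :
    dirDeriv X (fun z => g z - h z) y = dirDeriv X g y - dirDeriv X h y := by
  simp [dirDeriv, fderiv_fun_sub hg hh]

theorem dirDeriv_const_smul {X : V → V} {g : V → G} {y : V} (r : ℝ)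
    (hg : DifferentiableAt ℝ g y) :
    dirDeriv X (fun z => r • g z) y = r • dirDeriv X g y := by
  simp [dirDeriv, fderiv_fun_const_smul hg]

theorem dirDeriv_smul {X : V → V} {r : V → ℝ} {g : V → G} {y : V} (hr : DifferentiableAt ℝ r y)
    (hg : DifferentiableAt ℝ g y) :
    dirDeriv X (fun z => r z • g z) y = dirDeriv X r y • g y + r y • dirDeriv X g y := by
  simp [dirDeriv, fderiv_fun_smul hr hg, add_comm]

theorem dirDeriv_mul {X : V → V} {r q : V → ℝ} {y : V} (hr : DifferentiableAt ℝ r y)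
    (hq : DifferentiableAt ℝ q y) :
    dirDeriv X (fun z => r z * q z) y = dirDeriv X r y * q y + r y * dirDeriv X q y :=
  dirDeriv_smul hr hq

theorem dirDeriv_fderiv_apply {X Y : V → V} {g : V → G} {y : V} (hg : ContDiffAt ℝ 2 g y)
    (hY : DifferentiableAt ℝ Y y) :
    dirDeriv X (fun z => fderiv ℝ g z (Y z)) y =
      fderiv ℝ (fderiv ℝ g) y (X y) (Y y) + fderiv ℝ g y (dirDeriv X Y y) := by
  have h : DifferentiableAt ℝ (fderiv ℝ g) y :=
    (hg.fderiv_right (m := 1) (by norm_num)).differentiableAt (by simp)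
  have := (h.hasFDerivAt.clm_apply hY.hasFDerivAt).fderiv
  simp [dirDeriv, this, add_comm]

/-- Symmetry of the second derivative leaves only the bracket term. All integrability conditions
below come from this identity. -/
theorem dirDeriv_comm {X Y : V → V} {g : V → G} {y : V} (hg : ContDiffAt ℝ 2 g y)
    (hX : DifferentiableAt ℝ X y) (hY : DifferentiableAt ℝ Y y) :
    dirDeriv X (dirDeriv Y g) y - dirDeriv Y (dirDeriv X g) y =
      fderiv ℝ g y (dirDeriv X Y y - dirDeriv Y X y) := by
  have hs : IsSymmSndFDerivAt ℝ g y := hg.isSymmSndFDerivAt (by simp)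
  have h1 := dirDeriv_fderiv_apply (X := X) hg hY
  have h2 := dirDeriv_fderiv_apply (X := Y) hg hX
  have h3 := hs (X y) (Y y)
  change dirDeriv X (fun z => fderiv ℝ g z (Y z)) y - dirDeriv Y (fun z => fderiv ℝ g z (X z)) y = _
  rw [h1, h2, h3, map_sub]
  abel
end DirDeriv

section Inner
variable {V E : Type*} [NormedAddCommGroup V] [NormedSpace ℝ V]
  [NormedAddCommGroup E] [InnerProductSpace ℝ E]

theorem dirDeriv_inner {X : V → V} {g h : V → E} {y : V} (hg : DifferentiableAt ℝ g y)
    (hh : DifferentiableAt ℝ h y) :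
    dirDeriv X (fun z => ⟪g z, h z⟫) y = ⟪dirDeriv X g y, h y⟫ + ⟪g y, dirDeriv X h y⟫ := by
  simp [dirDeriv, fderiv_inner_apply ℝ hg hh, add_comm]

/-- Skew-symmetry of the connection forms of an orthonormal frame. -/
theorem inner_dirDeriv_of_inner_const {U : Set V} (hU : IsOpen U) {X : V → V} {g h : V → E}
    (hg : ContDiffOn ℝ ∞ g U) (hh : ContDiffOn ℝ ∞ h U) {r : ℝ}
    (hr : ∀ y ∈ U, ⟪g y, h y⟫ = r) {y : V} (hy : y ∈ U) :
    ⟪g y, dirDeriv X h y⟫ = - ⟪h y, dirDeriv X g y⟫ := by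
  have h1 := dirDeriv_congr (X := X) hU hr hy
  rw [dirDeriv_const, dirDeriv_inner (hg.differentiableAt_of_isOpen hU hy)
    (hh.differentiableAt_of_isOpen hU hy)] at h1
  rw [real_inner_comm (dirDeriv X g y)]
  linarith
end Inner

/-! ### The overdetermined system for the connection coefficients -/

section Scalar
variable {V : Type*} [NormedAddCommGroup V] [NormedSpace ℝ V]

/-- The analytic core: `h1` to `h3` are the Gauss–Codazzi equations, `h4` to `h7` the parallelism of
σ l ξ + (c a + e) η. Commuting t and s on c a + e gives a condition strong enough to force both
components to vanish. -/
theorem eq_zero_of_codazzi_of_parallel {U : Set V} (hU : IsOpen U) {t s : V → V}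
    {a b l e : V → ℝ} {c σ : ℝ} (hc : 0 < c) (hσ : σ ^ 2 + c ^ 2 = 1)
    (ht : ContDiffOn ℝ ∞ t U) (hs : ContDiffOn ℝ ∞ s U)
    (ha : ContDiffOn ℝ ∞ a U) (hb : ContDiffOn ℝ ∞ b U) (hl : ContDiffOn ℝ ∞ l U)
    (he : ContDiffOn ℝ ∞ e U) (hσ0 : 0 < σ)
    (hts : ∀ y ∈ U, dirDeriv t s y - dirDeriv s t y = (-(c * l y)) • s y)
    (h1 : ∀ y ∈ U, dirDeriv t l y - c * b y ^ 2 + c + a y * e y = -(c * l y ^ 2))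
    (h2 : ∀ y ∈ U, dirDeriv t b y = dirDeriv s a y - 2 * c * l y * b y)
    (h3 : ∀ y ∈ U, dirDeriv t e y - l y * a y - c * dirDeriv s b y = -(c * l y * e y))
    (h4 : ∀ y ∈ U, dirDeriv t l y = -((c * a y + e y) * a y))
    (h5 : ∀ y ∈ U, dirDeriv s l y = -((c * a y + e y) * b y))
    (h6 : ∀ y ∈ U, dirDeriv t (fun z => c * a z + e z) y = σ ^ 2 * (l y * a y))
    (h7 : ∀ y ∈ U, dirDeriv s (fun z => c * a z + e z) y = σ ^ 2 * (l y * b y)) :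
    ∀ y ∈ U, l y = 0 ∧ c * a y + e y = 0 := by
  have da : ∀ y ∈ U, DifferentiableAt ℝ a y := fun y hy => ha.differentiableAt_of_isOpen hU hy
  have db : ∀ y ∈ U, DifferentiableAt ℝ b y := fun y hy => hb.differentiableAt_of_isOpen hU hy
  have dl : ∀ y ∈ U, DifferentiableAt ℝ l y := fun y hy => hl.differentiableAt_of_isOpen hU hy
  have de : ∀ y ∈ U, DifferentiableAt ℝ e y := fun y hy => he.differentiableAt_of_isOpen hU hy
  -- Substituting `h4` in `h1` cancels the products a e, and c divides out.
  have gauss : ∀ y ∈ U, a y ^ 2 + b y ^ 2 = 1 + l y ^ 2 := by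
    intro y hy
    have := h1 y hy
    rw [h4 y hy] at this
    have : c * (a y ^ 2 + b y ^ 2) = c * (1 + l y ^ 2) := by linarith
    exact mul_left_cancel₀ hc.ne' this
  -- With m = c a + e, `h6` and `h7` give [t, s] m = -2 c σ² l² b by `h2`, whereas `hts` gives -c σ²
  -- l² b.
  have hlb : ∀ y ∈ U, l y ^ 2 * b y = 0 := by
    intro y hy
    have hm : ContDiffOn ℝ ∞ (fun z => c * a z + e z) U := (contDiffOn_const.mul ha).add he
    have := dirDeriv_comm (X := t) (Y := s) (y := y)
      ((hm.contDiffAt (hU.mem_nhds hy)).of_le ENat.LEInfty.out)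
      (ht.differentiableAt_of_isOpen hU hy) (hs.differentiableAt_of_isOpen hU hy)
    rw [dirDeriv_congr hU h7 hy, dirDeriv_congr hU h6 hy, hts y hy, map_smul] at this
    change _ = (-(c * l y)) • dirDeriv s (fun z => c * a z + e z) y at this
    rw [h7 y hy, dirDeriv_mul (differentiableAt_const _) ((dl y hy).fun_mul (db y hy)),
      dirDeriv_mul (differentiableAt_const _) ((dl y hy).fun_mul (da y hy)),
      dirDeriv_mul (dl y hy) (db y hy), dirDeriv_mul (dl y hy) (da y hy),
      dirDeriv_const, dirDeriv_const, h4 y hy, h5 y hy, h2 y hy, smul_eq_mul] at this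
    have : (σ ^ 2 * c) * (l y ^ 2 * b y) = 0 := by linarith
    exact (mul_eq_zero.mp this).resolve_left (by positivity)
  have hl0 : ∀ y ∈ U, l y = 0 := by
    intro y hy
    by_contra hne
    -- An open neighbourhood is needed because the identities b = 0 and a² = 1 + l² will be
    -- differentiated.
    obtain ⟨U', hU'U, hU', hyU', hl'⟩ : ∃ U' ⊆ U, IsOpen U' ∧ y ∈ U' ∧ ∀ z ∈ U', l z ≠ 0 :=
      ⟨U ∩ l ⁻¹' {0}ᶜ, Set.inter_subset_left,
        hl.continuousOn.isOpen_inter_preimage hU isOpen_compl_singleton, ⟨hy, hne⟩,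
        fun z hz => hz.2⟩
    have hb0 : ∀ z ∈ U', b z = 0 := fun z hz =>
      (mul_eq_zero.mp (hlb z (hU'U hz))).resolve_left (pow_ne_zero 2 (hl' z hz))
    have ha2 : ∀ z ∈ U', a z * a z = 1 + l z * l z := fun z hz => by
      have := gauss z (hU'U hz)
      rw [hb0 z hz] at this
      linarith
    have ha0 : ∀ z ∈ U', a z ≠ 0 := fun z hz h0 => by
      have := ha2 z hz
      rw [h0] at this
      nlinarith [mul_self_nonneg (l z)]
    have hTa : ∀ z ∈ U', dirDeriv t a z = -(l z * (c * a z + e z)) := fun z hz => by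
      have hz' := hU'U hz
      have := dirDeriv_congr (X := t) hU' ha2 hz
      rw [dirDeriv_mul (da z hz') (da z hz'), dirDeriv_add (differentiableAt_const _)
        ((dl z hz').fun_mul (dl z hz')), dirDeriv_mul (dl z hz') (dl z hz'), dirDeriv_const,
        h4 z hz'] at this
      refine mul_left_cancel₀ (ha0 z hz) ?_
      linarith
    have hTm : ∀ z ∈ U', dirDeriv t e z = σ ^ 2 * (l z * a z) + c * (l z * (c * a z + e z)) :=
      fun z hz => by
        have hz' := hU'U hz
        have := h6 z hz'
        rw [dirDeriv_add ((differentiableAt_const _).fun_mul (da z hz')) (de z hz'),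
          dirDeriv_mul (differentiableAt_const _) (da z hz'), dirDeriv_const, hTa z hz] at this
        linarith
    -- Comparing the two values of t e, from `hTm` and from `h3` with b = 0, the terms in l a cancel
    -- since σ² + c² = 1 and leave 2 c l e = 0.
    have he0 : ∀ z ∈ U', e z = 0 := fun z hz => by
      have h := h3 z (hU'U hz)
      rw [hTm z hz, dirDeriv_congr hU' hb0 hz, dirDeriv_const] at h
      have hσ' : σ ^ 2 = 1 - c ^ 2 := by linarith
      rw [hσ'] at h
      have : (2 * c * l z) * e z = 0 := by linarith
      exact (mul_eq_zero.mp this).resolve_left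
        (mul_ne_zero (by positivity) (hl' z hz))
    -- With b = e = 0 locally, `h3` reduces to l a = 0, although neither factor vanishes.
    have h := h3 y hy
    rw [dirDeriv_congr hU' he0 hyU', dirDeriv_congr hU' hb0 hyU', dirDeriv_const,
      dirDeriv_const, he0 y hyU'] at h
    have : l y * a y = 0 := by linarith
    exact (mul_ne_zero hne (ha0 y hyU')) this
  intro y hy
  refine ⟨hl0 y hy, ?_⟩
  have g := gauss y hy
  have e4 := h4 y hy
  have e5 := h5 y hy
  rw [dirDeriv_congr hU hl0 hy, dirDeriv_const] at e4 e5
  rw [hl0 y hy] at g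
  have : (c * a y + e y) * (a y ^ 2 + b y ^ 2) = 0 := by linear_combination a y * e4 + b y * e5
  rw [g] at this
  linarith
end Scalar

/-! ### Structure equations of the adapted frame -/

section AdaptedFrame

variable {V E : Type*} [NormedAddCommGroup V] [NormedSpace ℝ V]
  [NormedAddCommGroup E] [InnerProductSpace ℝ E]

theorem dirDeriv_sub_inner_smul (X : V → V) (k : E) {f : V → E} {y : V}
    (df : DifferentiableAt ℝ f y) : dirDeriv X (fun z => f z - ⟪k, f z⟫ • k) y =
      fderiv ℝ f y (X y) - ⟪k, fderiv ℝ f y (X y)⟫ • k := by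
  rw [dirDeriv_sub df
    (((differentiableAt_const k).inner ℝ df).fun_smul (differentiableAt_const k)),
    dirDeriv_smul ((differentiableAt_const k).inner ℝ df) (differentiableAt_const k),
    dirDeriv_inner (differentiableAt_const k) df]
  simp [dirDeriv_const]
  rfl

/-- An adapted orthonormal frame `N, W, S, η, k` along a parametrized surface `f` in a cylinder of
axis `k`: `N` is the unit normal of the cylinder, `c • W + σ • k` and `S` span the tangent plane and
are the images of the vector fields `t` and `s`. -/
structure IsAdaptedFrame (f : V → E) (k : E) (σ c : ℝ) (t s : V → V) (N W S η : V → E)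
    (U : Set V) : Prop where
  isOpen : IsOpen U
  f_smooth : ContDiffOn ℝ ∞ f U
  t_smooth : ContDiffOn ℝ ∞ t U
  s_smooth : ContDiffOn ℝ ∞ s U
  W_smooth : ContDiffOn ℝ ∞ W U
  S_smooth : ContDiffOn ℝ ∞ S U
  η_smooth : ContDiffOn ℝ ∞ η U
  N_eq : ∀ y ∈ U, N y = f y - ⟪k, f y⟫ • k
  df_t : ∀ y ∈ U, fderiv ℝ f y (t y) = c • W y + σ • k
  df_s : ∀ y ∈ U, fderiv ℝ f y (s y) = S y
  range_le : ∀ y ∈ U, ∀ v, ∃ α β : ℝ, v = α • t y + β • s y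
  NN : ∀ y ∈ U, ⟪N y, N y⟫ = 1
  WW : ∀ y ∈ U, ⟪W y, W y⟫ = 1
  SS : ∀ y ∈ U, ⟪S y, S y⟫ = 1
  ηη : ∀ y ∈ U, ⟪η y, η y⟫ = 1
  kk : ⟪k, k⟫ = 1
  NW : ∀ y ∈ U, ⟪N y, W y⟫ = 0
  NS : ∀ y ∈ U, ⟪N y, S y⟫ = 0
  Nη : ∀ y ∈ U, ⟪N y, η y⟫ = 0
  WS : ∀ y ∈ U, ⟪W y, S y⟫ = 0
  Wη : ∀ y ∈ U, ⟪W y, η y⟫ = 0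
  Sη : ∀ y ∈ U, ⟪S y, η y⟫ = 0
  kN : ∀ y ∈ U, ⟪k, N y⟫ = 0
  kW : ∀ y ∈ U, ⟪k, W y⟫ = 0
  kS : ∀ y ∈ U, ⟪k, S y⟫ = 0
  kη : ∀ y ∈ U, ⟪k, η y⟫ = 0
  expand : ∀ y ∈ U, ∀ v : E, v = ⟪N y, v⟫ • N y + ⟪W y, v⟫ • W y + ⟪S y, v⟫ • S y
    + ⟪η y, v⟫ • η y + ⟪k, v⟫ • k

namespace IsAdaptedFrame
variable {f : V → E} {k : E} {σ c : ℝ} {t s : V → V} {N W S η : V → E} {U : Set V}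
variable (h : IsAdaptedFrame f k σ c t s N W S η U)
include h

theorem N_smooth : ContDiffOn ℝ ∞ N U :=
  (h.f_smooth.sub ((contDiffOn_const.inner ℝ h.f_smooth).smul contDiffOn_const)).congr h.N_eq

theorem dirDeriv_N (X : V → V) {y : V} (hy : y ∈ U) :
    dirDeriv X N y = fderiv ℝ f y (X y) - ⟪k, fderiv ℝ f y (X y)⟫ • k := by
  rw [dirDeriv_congr h.isOpen h.N_eq hy,
    dirDeriv_sub_inner_smul X k (h.f_smooth.differentiableAt_of_isOpen h.isOpen hy)]

theorem dirDeriv_t_N {y : V} (hy : y ∈ U) : dirDeriv t N y = c • W y := by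
  rw [h.dirDeriv_N t hy, h.df_t y hy, inner_add_right, inner_smul_right, inner_smul_right,
    h.kW y hy, h.kk]
  simp

theorem dirDeriv_s_N {y : V} (hy : y ∈ U) : dirDeriv s N y = S y := by
  rw [h.dirDeriv_N s hy, h.df_s y hy, h.kS y hy]
  simp

theorem inner_k_dirDeriv (X : V → V) {g : V → E} (hg : ContDiffOn ℝ ∞ g U) {r : ℝ}
    (hr : ∀ y ∈ U, ⟪k, g y⟫ = r) {y : V} (hy : y ∈ U) : ⟪k, dirDeriv X g y⟫ = 0 := by
  rw [inner_dirDeriv_of_inner_const h.isOpen contDiffOn_const hg hr hy, dirDeriv_const]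
  simp

theorem inner_self_dirDeriv (X : V → V) {g : V → E} (hg : ContDiffOn ℝ ∞ g U)
    (hr : ∀ y ∈ U, ⟪g y, g y⟫ = 1) {y : V} (hy : y ∈ U) : ⟪g y, dirDeriv X g y⟫ = 0 := by
  have := inner_dirDeriv_of_inner_const (X := X) h.isOpen hg hg hr hy
  linarith

theorem lieBracket_aux {y : V} (hy : y ∈ U) :
    fderiv ℝ f y (dirDeriv t s y - dirDeriv s t y) = dirDeriv t S y - c • dirDeriv s W y := by
  rw [← dirDeriv_comm ((h.f_smooth.contDiffAt (h.isOpen.mem_nhds hy)).of_le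
    ENat.LEInfty.out)
    (h.t_smooth.differentiableAt_of_isOpen h.isOpen hy)
    (h.s_smooth.differentiableAt_of_isOpen h.isOpen hy)]
  have dW := h.W_smooth.differentiableAt_of_isOpen h.isOpen hy
  rw [dirDeriv_congr h.isOpen (g := dirDeriv s f) h.df_s hy,
    dirDeriv_congr h.isOpen (g := dirDeriv t f) h.df_t hy,
    dirDeriv_add (dW.fun_const_smul c) (differentiableAt_const _), dirDeriv_const_smul _ dW,
    dirDeriv_const, add_zero]

/-- The image of [t, s] is tS - c sW, which is orthogonal to the constant vector k because S and W
are. As ⟪k, T⟫ = σ ≠ 0 and ⟪k, S⟫ = 0, there is no t-component. -/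
theorem exists_lieBracket (hσ : σ ≠ 0) {y : V} (hy : y ∈ U) : ∃ β : ℝ,
    dirDeriv t s y - dirDeriv s t y = β • s y ∧
      dirDeriv t S y - c • dirDeriv s W y = β • S y := by
  obtain ⟨α, β, hαβ⟩ := h.range_le y hy (dirDeriv t s y - dirDeriv s t y)
  have h1 := h.lieBracket_aux hy
  rw [hαβ, map_add, map_smul, map_smul, h.df_t y hy, h.df_s y hy] at h1
  have h2 := congrArg (fun v => ⟪k, v⟫) h1
  simp only [inner_add_right, inner_sub_right, inner_smul_right,
    h.inner_k_dirDeriv s h.W_smooth h.kW hy, h.inner_k_dirDeriv t h.S_smooth h.kS hy,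
    h.kW y hy, h.kS y hy, h.kk] at h2
  have hα : α = 0 := by
    have : α * σ = 0 := by linarith
    exact (mul_eq_zero.mp this).resolve_right hσ
  subst hα
  exact ⟨β, by simpa using hαβ, by simpa using h1.symm⟩

/-- Pairing with the unit field S determines the remaining coefficient, since ⟪S, tS⟫ = 0. -/
theorem lieBracket_eq (hσ : σ ≠ 0) {y : V} (hy : y ∈ U) :
    dirDeriv t s y - dirDeriv s t y = (-(c * ⟪S y, dirDeriv s W y⟫)) • s y ∧
      dirDeriv t S y = c • dirDeriv s W y - (c * ⟪S y, dirDeriv s W y⟫) • S y := by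
  obtain ⟨β, h1, h2⟩ := h.exists_lieBracket hσ hy
  have h3 := congrArg (fun v => ⟪S y, v⟫) h2
  simp only [inner_sub_right, inner_smul_right, h.SS y hy,
    h.inner_self_dirDeriv t h.S_smooth h.SS hy] at h3
  have hβ : β = -(c * ⟪S y, dirDeriv s W y⟫) := by linarith
  subst hβ
  refine ⟨h1, ?_⟩
  rw [sub_eq_iff_eq_add] at h2
  rw [h2]
  module

theorem dirDeriv_s_W {y : V} (hy : y ∈ U) :
    dirDeriv s W y = ⟪S y, dirDeriv s W y⟫ • S y + ⟪η y, dirDeriv s W y⟫ • η y := by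
  conv_lhs => rw [h.expand y hy (dirDeriv s W y)]
  rw [h.inner_k_dirDeriv s h.W_smooth h.kW hy, h.inner_self_dirDeriv s h.W_smooth h.WW hy,
    inner_dirDeriv_of_inner_const h.isOpen h.N_smooth h.W_smooth h.NW hy, h.dirDeriv_s_N hy,
    h.WS y hy]
  module

/-- The S-component of c sW is exactly the bracket term, so only the η-component survives. This is
what reduces the connection to four functions. -/
theorem dirDeriv_t_S (hσ : σ ≠ 0) {y : V} (hy : y ∈ U) :
    dirDeriv t S y = (c * ⟪η y, dirDeriv s W y⟫) • η y := by
  rw [(h.lieBracket_eq hσ hy).2]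
  nth_rewrite 1 [h.dirDeriv_s_W hy]
  module

theorem dirDeriv_t_W (hσ : σ ≠ 0) {y : V} (hy : y ∈ U) :
    dirDeriv t W y = (-c) • N y + ⟪η y, dirDeriv t W y⟫ • η y := by
  conv_lhs => rw [h.expand y hy (dirDeriv t W y)]
  rw [h.inner_k_dirDeriv t h.W_smooth h.kW hy, h.inner_self_dirDeriv t h.W_smooth h.WW hy,
    inner_dirDeriv_of_inner_const h.isOpen h.N_smooth h.W_smooth h.NW hy, h.dirDeriv_t_N hy,
    inner_dirDeriv_of_inner_const h.isOpen h.S_smooth h.W_smooth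
      (fun y hy => (real_inner_comm _ _).trans (h.WS y hy)) hy,
    h.dirDeriv_t_S hσ hy, inner_smul_right, inner_smul_right, h.WW y hy, h.Wη y hy]
  module

theorem dirDeriv_s_S {y : V} (hy : y ∈ U) :
    dirDeriv s S y = (-1 : ℝ) • N y - ⟪S y, dirDeriv s W y⟫ • W y
      + ⟪η y, dirDeriv s S y⟫ • η y := by
  conv_lhs => rw [h.expand y hy (dirDeriv s S y)]
  rw [h.inner_k_dirDeriv s h.S_smooth h.kS hy, h.inner_self_dirDeriv s h.S_smooth h.SS hy,
    inner_dirDeriv_of_inner_const h.isOpen h.N_smooth h.S_smooth h.NS hy, h.dirDeriv_s_N hy,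
    inner_dirDeriv_of_inner_const h.isOpen h.W_smooth h.S_smooth h.WS hy, h.SS y hy]
  module

theorem dirDeriv_t_η (hσ : σ ≠ 0) {y : V} (hy : y ∈ U) :
    dirDeriv t η y = (-⟪η y, dirDeriv t W y⟫) • W y - (c * ⟪η y, dirDeriv s W y⟫) • S y := by
  conv_lhs => rw [h.expand y hy (dirDeriv t η y)]
  rw [h.inner_k_dirDeriv t h.η_smooth h.kη hy, h.inner_self_dirDeriv t h.η_smooth h.ηη hy,
    inner_dirDeriv_of_inner_const h.isOpen h.N_smooth h.η_smooth h.Nη hy, h.dirDeriv_t_N hy,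
    inner_dirDeriv_of_inner_const h.isOpen h.W_smooth h.η_smooth h.Wη hy,
    inner_dirDeriv_of_inner_const h.isOpen h.S_smooth h.η_smooth h.Sη hy, h.dirDeriv_t_S hσ hy,
    inner_smul_right, inner_smul_right, real_inner_comm, h.Wη y hy, h.ηη y hy]
  module

theorem dirDeriv_s_η {y : V} (hy : y ∈ U) :
    dirDeriv s η y = (-⟪η y, dirDeriv s W y⟫) • W y - ⟪η y, dirDeriv s S y⟫ • S y := by
  conv_lhs => rw [h.expand y hy (dirDeriv s η y)]
  rw [h.inner_k_dirDeriv s h.η_smooth h.kη hy, h.inner_self_dirDeriv s h.η_smooth h.ηη hy,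
    inner_dirDeriv_of_inner_const h.isOpen h.N_smooth h.η_smooth h.Nη hy, h.dirDeriv_s_N hy,
    inner_dirDeriv_of_inner_const h.isOpen h.W_smooth h.η_smooth h.Wη hy,
    inner_dirDeriv_of_inner_const h.isOpen h.S_smooth h.η_smooth h.Sη hy,
    real_inner_comm, h.Sη y hy]
  module

end IsAdaptedFrame

end AdaptedFrame

/-! ### Gauss–Codazzi equations and parallel mean curvature -/

section MeanCurvature

variable {V E : Type*} [NormedAddCommGroup V] [NormedSpace ℝ V]
  [NormedAddCommGroup E] [InnerProductSpace ℝ E]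

/-- `w` is normal at `y` to the surface `f`, in the cylinder of axis `k`. -/
def IsSurfaceNormal (f : V → E) (k : E) (y : V) (w : E) : Prop :=
  ⟪f y - ⟪k, f y⟫ • k, w⟫ = 0 ∧ ∀ v, ⟪fderiv ℝ f y v, w⟫ = 0

/-- `H` is a parallel mean curvature vector field of the surface `f`, in the cylinder of
axis `k`. -/
structure IsParallelMeanCurvature (f : V → E) (k : E) (H : V → E) (U : Set V) : Prop where
  normal : ∀ y ∈ U, IsSurfaceNormal f k y (H y)
  trace : ∀ y ∈ U, ∀ w, IsSurfaceNormal f k y w → ∀ t s : V,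
    ⟪fderiv ℝ f y t, fderiv ℝ f y t⟫ = 1 → ⟪fderiv ℝ f y s, fderiv ℝ f y s⟫ = 1 →
    ⟪fderiv ℝ f y t, fderiv ℝ f y s⟫ = 0 →
    2 * ⟪w, H y⟫ = ⟪w, fderiv ℝ (fderiv ℝ f) y t t⟫ + ⟪w, fderiv ℝ (fderiv ℝ f) y s s⟫
  parallel : ∀ y ∈ U, DifferentiableAt ℝ H y → ∀ w, IsSurfaceNormal f k y w →
    ∀ u, ⟪w, fderiv ℝ H y u⟫ = 0

theorem IsParallelMeanCurvature.mono {f : V → E} {k : E} {H : V → E} {U U' : Set V}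
    (h : IsParallelMeanCurvature f k H U) (hU : U' ⊆ U) : IsParallelMeanCurvature f k H U' :=
  ⟨fun y hy => h.normal y (hU hy), fun y hy => h.trace y (hU hy),
    fun y hy => h.parallel y (hU hy)⟩

namespace IsAdaptedFrame
variable {f : V → E} {k : E} {σ c : ℝ} {t s : V → V} {N W S η : V → E} {U : Set V}
variable (h : IsAdaptedFrame f k σ c t s N W S η U)
include h

/-- Commute t and s on W and on S, expand by the structure equations and compare components. The
S-component for W is the Gauss equation; the η-components for W and S are the Codazzi equations. -/
theorem codazzi {a b l e : V → ℝ}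
    (ha : ContDiffOn ℝ ∞ a U) (hb : ContDiffOn ℝ ∞ b U) (hl : ContDiffOn ℝ ∞ l U)
    (he : ContDiffOn ℝ ∞ e U)
    (htW : ∀ y ∈ U, dirDeriv t W y = (-c) • N y + a y • η y)
    (hsW : ∀ y ∈ U, dirDeriv s W y = l y • S y + b y • η y)
    (htS : ∀ y ∈ U, dirDeriv t S y = (c * b y) • η y)
    (hsS : ∀ y ∈ U, dirDeriv s S y = (-1 : ℝ) • N y - l y • W y + e y • η y)
    (htη : ∀ y ∈ U, dirDeriv t η y = (-a y) • W y - (c * b y) • S y)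
    (hsη : ∀ y ∈ U, dirDeriv s η y = (-b y) • W y - e y • S y)
    (hts : ∀ y ∈ U, dirDeriv t s y - dirDeriv s t y = (-(c * l y)) • s y)
    {y : V} (hy : y ∈ U) :
    (dirDeriv t l y - c * b y ^ 2 + c + a y * e y = -(c * l y ^ 2)) ∧
    (dirDeriv t b y = dirDeriv s a y - 2 * c * l y * b y) ∧
    (dirDeriv t e y - l y * a y - c * dirDeriv s b y = -(c * l y * e y)) := by
  have hU := h.isOpen
  have da := ha.differentiableAt_of_isOpen hU hy
  have db := hb.differentiableAt_of_isOpen hU hy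
  have dl := hl.differentiableAt_of_isOpen hU hy
  have de := he.differentiableAt_of_isOpen hU hy
  have dN := h.N_smooth.differentiableAt_of_isOpen hU hy
  have dW := h.W_smooth.differentiableAt_of_isOpen hU hy
  have dS := h.S_smooth.differentiableAt_of_isOpen hU hy
  have dη := h.η_smooth.differentiableAt_of_isOpen hU hy
  have dt := h.t_smooth.differentiableAt_of_isOpen hU hy
  have ds := h.s_smooth.differentiableAt_of_isOpen hU hy
  have cW := dirDeriv_comm (X := t) (Y := s) (y := y)
    ((h.W_smooth.contDiffAt (hU.mem_nhds hy)).of_le ENat.LEInfty.out) dt ds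
  have cS := dirDeriv_comm (X := t) (Y := s) (y := y)
    ((h.S_smooth.contDiffAt (hU.mem_nhds hy)).of_le ENat.LEInfty.out) dt ds
  rw [hts y hy, map_smul] at cW cS
  change _ = (-(c * l y)) • dirDeriv s W y at cW
  change _ = (-(c * l y)) • dirDeriv s S y at cS
  rw [dirDeriv_congr hU hsW hy, dirDeriv_congr hU htW hy,
    dirDeriv_add (dl.fun_smul dS) (db.fun_smul dη), dirDeriv_smul dl dS, dirDeriv_smul db dη,
    dirDeriv_add (dN.fun_const_smul _) (da.fun_smul dη), dirDeriv_const_smul _ dN,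
    dirDeriv_smul da dη, h.dirDeriv_s_N hy, hsW y hy, htS y hy, htη y hy, hsη y hy] at cW
  rw [dirDeriv_congr hU hsS hy, dirDeriv_congr hU htS hy,
    dirDeriv_add ((dN.fun_const_smul _).fun_sub (dl.fun_smul dW)) (de.fun_smul dη),
    dirDeriv_sub (dN.fun_const_smul _) (dl.fun_smul dW), dirDeriv_const_smul _ dN,
    dirDeriv_smul dl dW, dirDeriv_smul de dη,
    dirDeriv_smul ((differentiableAt_const c).fun_mul db) dη,
    dirDeriv_mul (differentiableAt_const c) db, dirDeriv_const,
    h.dirDeriv_t_N hy, hsS y hy, htW y hy, htη y hy, hsη y hy] at cS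
  have e1 := congrArg (fun v => ⟪S y, v⟫) cW
  have e2 := congrArg (fun v => ⟪η y, v⟫) cW
  have e3 := congrArg (fun v => ⟪η y, v⟫) cS
  have sw := (real_inner_comm _ _).trans (h.WS y hy)
  have ηw := (real_inner_comm _ _).trans (h.Wη y hy)
  have ηs := (real_inner_comm _ _).trans (h.Sη y hy)
  have sn := (real_inner_comm _ _).trans (h.NS y hy)
  have ηn := (real_inner_comm _ _).trans (h.Nη y hy)
  simp only [inner_add_right, inner_sub_right, inner_smul_right, h.SS y hy, h.Sη y hy, sw, ηw, ηs,
    h.ηη y hy, ηn] at e1 e2 e3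
  refine ⟨?_, ?_, ?_⟩ <;> linarith

theorem isSurfaceNormal_of_inner_eq_zero {y : V} (hy : y ∈ U) {w : E} (hN : ⟪N y, w⟫ = 0)
    (hT : ⟪c • W y + σ • k, w⟫ = 0) (hS : ⟪S y, w⟫ = 0) : IsSurfaceNormal f k y w := by
  refine ⟨by rwa [← h.N_eq y hy], fun v => ?_⟩
  obtain ⟨α, β, rfl⟩ := h.range_le y hy v
  rw [map_add, map_smul, map_smul, h.df_t y hy, h.df_s y hy, inner_add_left, inner_smul_left,
    inner_smul_left, hT, hS]
  simp

theorem isSurfaceNormal_ξ {y : V} (hy : y ∈ U) :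
    IsSurfaceNormal f k y ((-σ) • W y + c • k) := by
  apply h.isSurfaceNormal_of_inner_eq_zero hy <;>
  simp only [inner_add_left, inner_add_right, inner_smul_left, inner_smul_right, h.NW y hy,
    real_inner_comm k, h.kN y hy, h.kS y hy, h.WW y hy, h.kW y hy, h.kk,
    (real_inner_comm _ _).trans (h.WS y hy)] <;> simp [mul_comm]

theorem isSurfaceNormal_η {y : V} (hy : y ∈ U) : IsSurfaceNormal f k y (η y) := by
  apply h.isSurfaceNormal_of_inner_eq_zero hy <;>
  simp [inner_add_left, inner_smul_left, h.Nη y hy, h.Sη y hy, h.Wη y hy, h.kη y hy]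

/-- The trace is taken in the orthonormal basis T, S. Here tT = c tW has normal part c a η, and the
normal part of sS is σ l ξ + e η, the ξ-part coming from its W-component -l. -/
theorem two_smul_eq (hσc : σ ^ 2 + c ^ 2 = 1) {H : V → E}
    (hH : IsParallelMeanCurvature f k H U) {y : V} (hy : y ∈ U) :
    (2 : ℝ) • H y = (σ * ⟪S y, dirDeriv s W y⟫) • ((-σ) • W y + c • k) +
      (c * ⟪η y, dirDeriv t W y⟫ + ⟪η y, dirDeriv s S y⟫) • η y := by
  have hU := h.isOpen
  have dt := h.t_smooth.differentiableAt_of_isOpen hU hy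
  have ds := h.s_smooth.differentiableAt_of_isOpen hU hy
  have dW := h.W_smooth.differentiableAt_of_isOpen hU hy
  have hf : ContDiffAt ℝ 2 f y := (h.f_smooth.contDiffAt (hU.mem_nhds hy)).of_le ENat.LEInfty.out
  have ht := dirDeriv_fderiv_apply (X := t) hf dt
  have hs := dirDeriv_fderiv_apply (X := s) hf ds
  rw [dirDeriv_congr hU h.df_t hy, dirDeriv_add (dW.fun_const_smul c) (differentiableAt_const _),
    dirDeriv_const_smul _ dW, dirDeriv_const, add_zero] at ht
  rw [dirDeriv_congr hU h.df_s hy] at hs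
  -- The second derivative of f on (t, t) differs from t(T) by a tangent vector, which w does not
  -- see; likewise for s.
  have key : ∀ w, IsSurfaceNormal f k y w →
      2 * ⟪w, H y⟫ = c * ⟪w, dirDeriv t W y⟫ + ⟪w, dirDeriv s S y⟫ := by
    intro w hw
    rw [hH.trace y hy w hw (t y) (s y), ← inner_smul_right, ht, hs, inner_add_right,
      inner_add_right, real_inner_comm (fderiv ℝ f y _), hw.2, real_inner_comm (fderiv ℝ f y _),
      hw.2]
    · ring
    all_goals
      simp only [h.df_t y hy, h.df_s y hy, inner_add_left, inner_add_right, inner_smul_left,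
        inner_smul_right, h.SS y hy, h.WW y hy, h.kk, h.WS y hy, h.kS y hy, h.kW y hy,
        real_inner_comm k, conj_trivial, mul_zero, mul_one, add_zero, zero_add]
    linear_combination hσc
  have k1 := key _ (h.isSurfaceNormal_ξ hy)
  have k2 := key _ (h.isSurfaceNormal_η hy)
  have hWs : ⟪W y, dirDeriv s S y⟫ = -⟪S y, dirDeriv s W y⟫ :=
    inner_dirDeriv_of_inner_const h.isOpen h.W_smooth h.S_smooth h.WS hy
  simp only [inner_add_left, inner_smul_left, h.inner_k_dirDeriv t h.W_smooth h.kW hy,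
    h.inner_k_dirDeriv s h.S_smooth h.kS hy, h.inner_self_dirDeriv t h.W_smooth h.WW hy,
    hWs] at k1
  have n := hH.normal y hy
  have n1 := n.1
  rw [← h.N_eq y hy] at n1
  have n2 := n.2 (t y)
  have n3 := n.2 (s y)
  rw [h.df_t y hy, inner_add_left, inner_smul_left, inner_smul_left] at n2
  rw [h.df_s y hy] at n3
  simp only [conj_trivial] at k1 n2
  -- The components of H along ξ and T are known (`k1`, and `n2` which is zero); rotate back to W
  -- and k.
  have kW : 2 * ⟪W y, H y⟫ = -σ * (σ * ⟪S y, dirDeriv s W y⟫) := by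
    linear_combination (-σ) * k1 + 2 * c * n2 - 2 * ⟪W y, H y⟫ * hσc
  have kk : 2 * ⟪k, H y⟫ = c * (σ * ⟪S y, dirDeriv s W y⟫) := by
    linear_combination c * k1 + 2 * σ * n2 - 2 * ⟪k, H y⟫ * hσc
  rw [h.expand y hy (H y), n1, n3, smul_add, smul_add, smul_add, smul_add, smul_smul, smul_smul,
    smul_smul, smul_smul, smul_smul, kW, kk, k2]
  module

theorem eq_zero_of_isParallelMeanCurvature (hσ : 0 < σ) (hc : 0 < c) (hσc : σ ^ 2 + c ^ 2 = 1)
    {H : V → E} (hH : IsParallelMeanCurvature f k H U) : ∀ y ∈ U, H y = 0 := by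
  have hU := h.isOpen
  have sm : ∀ {g g' : V → E} {X : V → V}, ContDiffOn ℝ ∞ X U → ContDiffOn ℝ ∞ g U →
      ContDiffOn ℝ ∞ g' U → ContDiffOn ℝ ∞ (fun y => ⟪g y, dirDeriv X g' y⟫) U :=
    fun hX hg hg' => hg.inner ℝ (contDiffOn_dirDeriv hU hX hg')
  have ha := sm h.t_smooth h.η_smooth h.W_smooth
  have hb := sm h.s_smooth h.η_smooth h.W_smooth
  have hl := sm h.s_smooth h.S_smooth h.W_smooth
  have he := sm h.s_smooth h.η_smooth h.S_smooth
  have htW := fun y hy => h.dirDeriv_t_W hσ.ne' (y := y) hy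
  have hsW := fun y hy => h.dirDeriv_s_W (y := y) hy
  have htS := fun y hy => h.dirDeriv_t_S hσ.ne' (y := y) hy
  have hsS := fun y hy => h.dirDeriv_s_S (y := y) hy
  have htη := fun y hy => h.dirDeriv_t_η hσ.ne' (y := y) hy
  have hsη := fun y hy => h.dirDeriv_s_η (y := y) hy
  have hts := fun y hy => (h.lieBracket_eq hσ.ne' (y := y) hy).1
  have h2H := fun y hy => h.two_smul_eq hσc hH (y := y) hy
  generalize hgb : (fun y => ⟪η y, dirDeriv s W y⟫) = b at *
  generalize hgl : (fun y => ⟪S y, dirDeriv s W y⟫) = l at *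
  generalize hga : (fun y => ⟪η y, dirDeriv t W y⟫) = a at *
  generalize hge : (fun y => ⟪η y, dirDeriv s S y⟫) = e at *
  simp only [fun y => congrFun hga y, fun y => congrFun hgb y, fun y => congrFun hgl y,
    fun y => congrFun hge y] at htW hsW htS hsS htη hsη hts h2H
  have cod := fun y hy => h.codazzi ha hb hl he htW hsW htS hsS htη hsη hts (y := y) hy
  have hm : ContDiffOn ℝ ∞ (fun z => c * a z + e z) U := (contDiffOn_const.mul ha).add he
  -- Parallelism is only available where H is differentiable; smoothness is read off from the
  -- explicit formula for 2H.
  have hHsm : ContDiffOn ℝ ∞ H U := by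
    refine ContDiffOn.congr (f := fun y => (1 / 2 : ℝ) • ((σ * l y) • ((-σ) • W y + c • k) +
      (c * a y + e y) • η y)) ?_ fun y hy => ?_
    · exact contDiffOn_const.smul (((contDiffOn_const.mul hl).smul
        ((contDiffOn_const.smul h.W_smooth).add contDiffOn_const)).add (hm.smul h.η_smooth))
    · rw [← h2H y hy, smul_smul]
      norm_num
  have par : ∀ y ∈ U, ∀ X : V → V, ∀ w, IsSurfaceNormal f k y w →
      ⟪w, (σ * dirDeriv X l y) • ((-σ) • W y + c • k) + (σ * l y) • (-σ) • dirDeriv X W y +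
        (dirDeriv X (fun z => c * a z + e z) y • η y + (c * a y + e y) • dirDeriv X η y)⟫ = 0 := by
    intro y hy X w hw
    have dH := hHsm.differentiableAt_of_isOpen hU hy
    have dl := hl.differentiableAt_of_isOpen hU hy
    have dm := hm.differentiableAt_of_isOpen hU hy
    have dW := h.W_smooth.differentiableAt_of_isOpen hU hy
    have dη := h.η_smooth.differentiableAt_of_isOpen hU hy
    have e1 := dirDeriv_congr (X := X) hU h2H hy
    rw [dirDeriv_const_smul _ dH, dirDeriv_add (((differentiableAt_const σ).fun_mul dl).fun_smul
      ((dW.fun_const_smul _).fun_add (differentiableAt_const _))) (dm.fun_smul dη),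
      dirDeriv_smul ((differentiableAt_const σ).fun_mul dl)
      ((dW.fun_const_smul _).fun_add (differentiableAt_const _)),
      dirDeriv_mul (differentiableAt_const σ) dl, dirDeriv_const, zero_mul, zero_add,
      dirDeriv_add (dW.fun_const_smul _) (differentiableAt_const _), dirDeriv_const_smul _ dW,
      dirDeriv_const, add_zero, dirDeriv_smul dm dη] at e1
    rw [← e1, inner_smul_right]
    simp only [dirDeriv, hH.parallel y hy dH w hw, mul_zero]
  -- Testing against ξ yields the derivatives of l, testing against η those of c a + e.
  have P1 := fun y hy X => par y hy X _ (h.isSurfaceNormal_ξ hy)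
  have P2 := fun y hy X => par y hy X _ (h.isSurfaceNormal_η hy)
  have z := eq_zero_of_codazzi_of_parallel hU hc hσc h.t_smooth h.s_smooth ha hb hl he hσ hts
    (fun y hy => (cod y hy).1) (fun y hy => (cod y hy).2.1) (fun y hy => (cod y hy).2.2)
    ?_ ?_ ?_ ?_
  · intro y hy
    obtain ⟨z1, z2⟩ := z y hy
    have := h2H y hy
    rw [z1, z2] at this
    simpa using this
  all_goals
    intro y hy
    have ηw := (real_inner_comm _ _).trans (h.Wη y hy)
    have ηs := (real_inner_comm _ _).trans (h.Sη y hy)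
    have ηn := (real_inner_comm _ _).trans (h.Nη y hy)
    have wn := (real_inner_comm _ _).trans (h.NW y hy)
    have p1 := P1 y hy t
    have p2 := P1 y hy s
    have p3 := P2 y hy t
    have p4 := P2 y hy s
    rw [htW y hy, htη y hy] at p1 p3
    rw [hsW y hy, hsη y hy] at p2 p4
    simp only [inner_add_left, inner_add_right, inner_sub_right, inner_smul_left, inner_smul_right,
      h.WW y hy, h.WS y hy, h.Wη y hy, h.kW y hy, h.kS y hy, h.kN y hy, h.kη y hy, h.kk, ηw, ηs, ηn,
      h.ηη y hy, wn, real_inner_comm k, conj_trivial] at p1 p2 p3 p4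
  · refine mul_left_cancel₀ hσ.ne' ?_
    linear_combination p1 - σ * dirDeriv t l y * hσc
  · refine mul_left_cancel₀ hσ.ne' ?_
    linear_combination p2 - σ * dirDeriv s l y * hσc
  · linarith
  · linarith

end IsAdaptedFrame

end MeanCurvature

/-! ### Orthonormal families and Gram–Schmidt -/

section Orthonormal
variable {E : Type*} [NormedAddCommGroup E] [InnerProductSpace ℝ E]

theorem Orthonormal.sum_inner_smul_of_card_eq_finrank {ι : Type*} [Fintype ι] {v : ι → E}
    (hv : Orthonormal ℝ v) (hcard : Fintype.card ι = Module.finrank ℝ E) [Nonempty ι] (w : E) :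
    ∑ i, ⟪v i, w⟫ • v i = w := by
  have := (OrthonormalBasis.mk hv (by
    rw [hv.linearIndependent.span_eq_top_of_card_eq_finrank hcard])).sum_repr w
  simpa [OrthonormalBasis.repr_apply_apply] using this

theorem exists_unit_inner_eq_zero {n : ℕ} (hn : n < Module.finrank ℝ E) (v : Fin n → E) :
    ∃ w : E, ⟪w, w⟫ = 1 ∧ ∀ i, ⟪v i, w⟫ = 0 := by
  have : FiniteDimensional ℝ E := FiniteDimensional.of_finrank_pos (by omega)
  have h1 : Module.finrank ℝ (Submodule.span ℝ (Set.range v)) ≤ n := by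
    exact (finrank_range_le_card (R := ℝ) v).trans (by simp)
  have h2 := (Submodule.span ℝ (Set.range v)).finrank_add_finrank_orthogonal
  have h3 : 0 < Module.finrank ℝ (Submodule.span ℝ (Set.range v))ᗮ := by omega
  have := Module.nontrivial_of_finrank_pos h3
  obtain ⟨⟨w, hw⟩, hw0⟩ := exists_ne (0 : (Submodule.span ℝ (Set.range v))ᗮ)
  have hw0' : w ≠ 0 := fun h => hw0 (Subtype.ext h)
  refine ⟨‖w‖⁻¹ • w, ?_, fun i => ?_⟩
  · rw [real_inner_self_eq_norm_sq, norm_smul, norm_inv, norm_norm,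
      inv_mul_cancel₀ (norm_ne_zero_iff.2 hw0'), one_pow]
  · rw [inner_smul_right, Submodule.mem_orthogonal _ _ |>.1 hw _ (Submodule.subset_span ⟨i, rfl⟩),
      mul_zero]

theorem inner_normalize_self {w : E} (hw : w ≠ 0) : ⟪‖w‖⁻¹ • w, ‖w‖⁻¹ • w⟫ = 1 := by
  rw [real_inner_self_eq_norm_sq, norm_smul, norm_inv, norm_norm,
      inv_mul_cancel₀ (norm_ne_zero_iff.2 hw), one_pow]

variable {V : Type*} [NormedAddCommGroup V] [NormedSpace ℝ V]

theorem exists_eq_add_smul_of_orthonormal_map (hV : Module.finrank ℝ V = 2) (A : V →L[ℝ] E)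
    {t s : V} (h1 : ⟪A t, A t⟫ = 1) (h2 : ⟪A s, A s⟫ = 1) (h3 : ⟪A t, A s⟫ = 0) (v : V) :
    ∃ α β : ℝ, v = α • t + β • s := by
  have li : LinearIndependent ℝ ![t, s] := by
    rw [LinearIndependent.pair_iff]
    intro x y hxy
    have h := congrArg A hxy
    rw [map_add, map_smul, map_smul, map_zero] at h
    have ht := congrArg (fun w => ⟪A t, w⟫) h
    have hs := congrArg (fun w => ⟪A s, w⟫) h
    simp only [inner_add_right, inner_smul_right, h1, h2, h3, real_inner_comm (A t) (A s),
      inner_zero_right] at ht hs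
    constructor <;> linarith
  have hsp := li.span_eq_top_of_card_eq_finrank (by simp [hV])
  have : v ∈ Submodule.span ℝ (Set.range ![t, s]) := hsp ▸ Submodule.mem_top
  rw [Matrix.range_cons, Matrix.range_cons, Matrix.range_empty, Set.union_empty,
    Set.singleton_union, Submodule.mem_span_pair] at this
  obtain ⟨α, β, h⟩ := this
  exact ⟨α, β, h.symm⟩

theorem ContDiffOn.normalize {U : Set V} {g : V → E} (hg : ContDiffOn ℝ ∞ g U)
    (h0 : ∀ y ∈ U, g y ≠ 0) : ContDiffOn ℝ ∞ (fun y => ‖g y‖⁻¹ • g y) U :=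
  ((hg.norm ℝ h0).inv fun y hy => norm_ne_zero_iff.2 (h0 y hy)).smul hg

/-- Gram–Schmidt for the pulled-back metric, performed on vector fields of the parameter domain so
that the result consists of derivatives of f. -/
theorem exists_orthonormal_dirDeriv {U : Set V} (hU : IsOpen U) {f : V → E}
    (hf : ContDiffOn ℝ ∞ f U) (hinj : ∀ y ∈ U, Function.Injective (fderiv ℝ f y))
    (hV : Module.finrank ℝ V = 2) : ∃ v w : V → V, ContDiffOn ℝ ∞ v U ∧ ContDiffOn ℝ ∞ w U ∧
      ∀ y ∈ U, ⟪dirDeriv v f y, dirDeriv v f y⟫ = 1 ∧ ⟪dirDeriv w f y, dirDeriv w f y⟫ = 1 ∧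
        ⟪dirDeriv v f y, dirDeriv w f y⟫ = 0 := by
  have : FiniteDimensional ℝ V := FiniteDimensional.of_finrank_pos (by omega)
  let b := Module.finBasisOfFinrankEq ℝ V hV
  have hne : ∀ X : V → V, ∀ y ∈ U, X y ≠ 0 → dirDeriv X f y ≠ 0 := fun X y hy hX h =>
    hX (hinj y hy (h.trans (map_zero _).symm))
  have hsc : ∀ (r : V → ℝ) (X : V → V) (y : V),
      dirDeriv (fun z => r z • X z) f y = r y • dirDeriv X f y := fun r X y => map_smul _ _ _
  have sm1 : ContDiffOn ℝ ∞ (dirDeriv (fun _ => b 0) f) U :=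
    contDiffOn_dirDeriv hU contDiffOn_const hf
  have sm2 : ContDiffOn ℝ ∞ (dirDeriv (fun _ => b 1) f) U :=
    contDiffOn_dirDeriv hU contDiffOn_const hf
  have ne1 : ∀ y ∈ U, dirDeriv (fun _ => b 0) f y ≠ 0 := fun y hy => hne _ y hy (b.ne_zero 0)
  let v : V → V := fun y => ‖dirDeriv (fun _ => b 0) f y‖⁻¹ • b 0
  have hv : ∀ y, dirDeriv v f y =
      ‖dirDeriv (fun _ => b 0) f y‖⁻¹ • dirDeriv (fun _ => b 0) f y := fun y => hsc _ _ y
  have smv : ContDiffOn ℝ ∞ v U :=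
    ((sm1.norm ℝ ne1).inv fun y hy => norm_ne_zero_iff.2 (ne1 y hy)).smul contDiffOn_const
  have smdv := contDiffOn_dirDeriv hU smv hf
  have vv : ∀ y ∈ U, ⟪dirDeriv v f y, dirDeriv v f y⟫ = 1 := fun y hy => by
    rw [hv y, inner_normalize_self (ne1 y hy)]
  let g : V → V := fun y => b 1 - ⟪dirDeriv v f y, dirDeriv (fun _ => b 1) f y⟫ • v y
  have smg : ContDiffOn ℝ ∞ g U := contDiffOn_const.sub ((smdv.inner ℝ sm2).smul smv)
  have hg : ∀ y, dirDeriv g f y = dirDeriv (fun _ => b 1) f y -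
      ⟪dirDeriv v f y, dirDeriv (fun _ => b 1) f y⟫ • dirDeriv v f y := fun y => by
    simp [dirDeriv, g, v]
  -- Since v is a multiple of `b 0`, the coordinate of `g` along `b 1` is 1.
  have neg : ∀ y ∈ U, dirDeriv g f y ≠ 0 := fun y hy => hne _ y hy fun h => by
    have := congrArg (fun w => b.repr w 1) h
    simp [g, v] at this
  have smdg := contDiffOn_dirDeriv hU smg hf
  refine ⟨v, fun y => ‖dirDeriv g f y‖⁻¹ • g y, smv,
    ((smdg.norm ℝ neg).inv fun y hy => norm_ne_zero_iff.2 (neg y hy)).smul smg,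
    fun y hy => ⟨vv y hy, ?_, ?_⟩⟩
  · rw [hsc, inner_normalize_self (neg y hy)]
  · rw [hsc (fun y => ‖dirDeriv g f y‖⁻¹) g, inner_smul_right, hg, inner_sub_right,
      inner_smul_right, vv y hy]
    simp

end Orthonormal

/-! ### Existence of the adapted frame -/

section Frame
variable {V E : Type*} [NormedAddCommGroup V] [NormedSpace ℝ V]
  [NormedAddCommGroup E] [InnerProductSpace ℝ E]

theorem inner_cylinderNormal_fderiv {U : Set V} (hU : IsOpen U) {f : V → E}
    (hf : ContDiffOn ℝ ∞ f U) {k : E} (hk : ⟪k, k⟫ = 1)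
    (hN : ∀ y ∈ U, ⟪f y - ⟪k, f y⟫ • k, f y - ⟪k, f y⟫ • k⟫ = 1) {y : V} (hy : y ∈ U) (u : V) :
    ⟪f y - ⟪k, f y⟫ • k, fderiv ℝ f y u⟫ = 0 := by
  have sm : ContDiffOn ℝ ∞ (fun y => f y - ⟪k, f y⟫ • k) U :=
    hf.sub ((contDiffOn_const.inner ℝ hf).smul contDiffOn_const)
  have h1 := inner_dirDeriv_of_inner_const (X := fun _ => u) hU sm sm hN hy
  rw [dirDeriv_sub_inner_smul _ _ (hf.differentiableAt_of_isOpen hU hy), inner_sub_right,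
    inner_smul_right] at h1
  have h2 : ⟪f y - ⟪k, f y⟫ • k, k⟫ = 0 := by
    rw [inner_sub_left, inner_smul_left, hk, real_inner_comm]
    simp
  rw [h2] at h1
  linarith

/-- The tangential part of k has constant length σ ≠ 0, so dividing by σ gives T smoothly; S is T
rotated by a right angle, and c ≠ 0 allows W to be solved from T = c W + σ k. Only η requires a
choice, and hence a smaller domain. -/
theorem exists_isAdaptedFrame {U : Set V} (hU : IsOpen U) {f : V → E}
    (hf : ContDiffOn ℝ ∞ f U) (hinj : ∀ y ∈ U, Function.Injective (fderiv ℝ f y))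
    (hV : Module.finrank ℝ V = 2) (hE : Module.finrank ℝ E = 5) {k : E} (hk : ⟪k, k⟫ = 1)
    (hN : ∀ y ∈ U, ⟪f y - ⟪k, f y⟫ • k, f y - ⟪k, f y⟫ • k⟫ = 1) {σ c : ℝ}
    (hσ : σ ≠ 0) (hc : c ≠ 0) (hσc : σ ^ 2 + c ^ 2 = 1)
    (hangle : ∀ y ∈ U, ∃ v, ⟪fderiv ℝ f y v, fderiv ℝ f y v⟫ = 1 ∧
      ∀ u, ⟪fderiv ℝ f y u, k⟫ = σ * ⟪fderiv ℝ f y u, fderiv ℝ f y v⟫) {y₀ : V} (hy₀ : y₀ ∈ U) :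
    ∃ U' ⊆ U, y₀ ∈ U' ∧ ∃ (t s : V → V) (N W S η : V → E),
      IsAdaptedFrame f k σ c t s N W S η U' := by
  obtain ⟨v, w, smv, smw, hvw⟩ := exists_orthonormal_dirDeriv hU hf hinj hV
  have smA := contDiffOn_dirDeriv hU smv hf
  have smB := contDiffOn_dirDeriv hU smw hf
  have smp : ContDiffOn ℝ ∞ (fun y => ⟪dirDeriv v f y, k⟫) U := smA.inner ℝ contDiffOn_const
  have smq : ContDiffOn ℝ ∞ (fun y => ⟪dirDeriv w f y, k⟫) U := smB.inner ℝ contDiffOn_const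
  -- The left side is the squared length of the tangential part of k, which is σ times a unit vector
  -- by `hangle`.
  have hpq : ∀ y ∈ U, ⟪dirDeriv v f y, k⟫ ^ 2 + ⟪dirDeriv w f y, k⟫ ^ 2 = σ ^ 2 := by
    intro y hy
    obtain ⟨h1, h2, h3⟩ := hvw y hy
    obtain ⟨x, hx, hxk⟩ := hangle y hy
    obtain ⟨α, β, rfl⟩ := exists_eq_add_smul_of_orthonormal_map hV (fderiv ℝ f y) h1 h2 h3 x
    have e1 := hxk (v y)
    have e2 := hxk (w y)
    change ⟪dirDeriv v f y, k⟫ = _ at e1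
    change ⟪dirDeriv w f y, k⟫ = _ at e2
    rw [map_add, map_smul, map_smul] at hx e1 e2
    change ⟪α • dirDeriv v f y + β • dirDeriv w f y, α • dirDeriv v f y + β • dirDeriv w f y⟫
      = 1 at hx
    change _ = σ * ⟪dirDeriv v f y, α • dirDeriv v f y + β • dirDeriv w f y⟫ at e1
    change _ = σ * ⟪dirDeriv w f y, α • dirDeriv v f y + β • dirDeriv w f y⟫ at e2
    simp only [inner_add_left, inner_add_right, inner_smul_left, inner_smul_right, h1, h2, h3,
      real_inner_comm (dirDeriv v f y) (dirDeriv w f y), conj_trivial] at hx e1 e2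
    rw [e1, e2]
    linear_combination σ ^ 2 * hx
  let t : V → V := fun y => σ⁻¹ • (⟪dirDeriv v f y, k⟫ • v y + ⟪dirDeriv w f y, k⟫ • w y)
  let s : V → V := fun y => σ⁻¹ • (⟪dirDeriv v f y, k⟫ • w y - ⟪dirDeriv w f y, k⟫ • v y)
  have smt : ContDiffOn ℝ ∞ t U := contDiffOn_const.smul ((smp.smul smv).add (smq.smul smw))
  have sms : ContDiffOn ℝ ∞ s U := contDiffOn_const.smul ((smp.smul smw).sub (smq.smul smv))
  have smT := contDiffOn_dirDeriv hU smt hf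
  have smS := contDiffOn_dirDeriv hU sms hf
  have hT : ∀ y, dirDeriv t f y = σ⁻¹ • (⟪dirDeriv v f y, k⟫ • dirDeriv v f y +
      ⟪dirDeriv w f y, k⟫ • dirDeriv w f y) := fun y => by simp [dirDeriv, t]
  have hS : ∀ y, dirDeriv s f y = σ⁻¹ • (⟪dirDeriv v f y, k⟫ • dirDeriv w f y -
      ⟪dirDeriv w f y, k⟫ • dirDeriv v f y) := fun y => by simp [dirDeriv, s]
  have hframe : ∀ y ∈ U, ⟪dirDeriv t f y, dirDeriv t f y⟫ = 1 ∧
      ⟪dirDeriv s f y, dirDeriv s f y⟫ = 1 ∧ ⟪dirDeriv t f y, dirDeriv s f y⟫ = 0 ∧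
      ⟪k, dirDeriv t f y⟫ = σ ∧ ⟪k, dirDeriv s f y⟫ = 0 := by
    intro y hy
    obtain ⟨h1, h2, h3⟩ := hvw y hy
    have e := hpq y hy
    have h4 : σ⁻¹ * σ⁻¹ * σ ^ 2 = 1 := by field_simp
    have h5 : σ⁻¹ * σ ^ 2 = σ := by field_simp
    simp only [hT, hS, inner_add_left, inner_add_right, inner_sub_left, inner_sub_right,
      inner_smul_left, inner_smul_right, h1, h2, h3,
      real_inner_comm (dirDeriv v f y) (dirDeriv w f y), conj_trivial, real_inner_comm _ k]
    refine ⟨?_, ?_, ?_, ?_, ?_⟩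
    · linear_combination σ⁻¹ * σ⁻¹ * e + h4
    · linear_combination σ⁻¹ * σ⁻¹ * e + h4
    · ring
    · linear_combination σ⁻¹ * e + h5
    · ring
  let N : V → E := fun y => f y - ⟪k, f y⟫ • k
  have smN : ContDiffOn ℝ ∞ N U :=
    hf.sub ((contDiffOn_const.inner ℝ hf).smul contDiffOn_const)
  have kN : ∀ y, ⟪k, N y⟫ = 0 := fun y => by
    simp only [N, inner_sub_right, inner_smul_right, hk]
    ring
  have Nf : ∀ y ∈ U, ∀ u, ⟪N y, fderiv ℝ f y u⟫ = 0 := fun y hy u =>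
    inner_cylinderNormal_fderiv hU hf hk hN hy u
  let W : V → E := fun y => c⁻¹ • (dirDeriv t f y - σ • k)
  have smW : ContDiffOn ℝ ∞ W U := contDiffOn_const.smul (smT.sub contDiffOn_const)
  have NW : ∀ y ∈ U, ⟪N y, W y⟫ = 0 := fun y hy => by
    have := Nf y hy (t y)
    simp only [W, inner_smul_right, inner_sub_right, real_inner_comm k, kN]
    simp [dirDeriv, this]
  have WW : ∀ y ∈ U, ⟪W y, W y⟫ = 1 := fun y hy => by
    obtain ⟨h1, h2, h3, h4, h5⟩ := hframe y hy
    simp only [W, inner_smul_left, inner_smul_right, inner_sub_left, inner_sub_right, h1, h4,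
      real_inner_comm k, hk, conj_trivial]
    field_simp
    linarith
  have kW : ∀ y ∈ U, ⟪k, W y⟫ = 0 := fun y hy => by
    obtain ⟨h1, h2, h3, h4, h5⟩ := hframe y hy
    simp only [W, inner_smul_right, inner_sub_right, h4, hk]
    ring
  have WS : ∀ y ∈ U, ⟪W y, dirDeriv s f y⟫ = 0 := fun y hy => by
    obtain ⟨h1, h2, h3, h4, h5⟩ := hframe y hy
    simp only [W, inner_smul_left, inner_sub_left, h3, h5]
    ring
  -- A unit vector orthogonal to the other four at the base point; `g` is its projection orthogonal
  -- to those four at nearby points, nonzero near `y₀`.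
  obtain ⟨η₀, hη₀, hη₀'⟩ := exists_unit_inner_eq_zero (E := E) (n := 4) (by omega)
    ![N y₀, W y₀, dirDeriv s f y₀, k]
  let g : V → E := fun y => η₀ - ⟪N y, η₀⟫ • N y - ⟪W y, η₀⟫ • W y
    - ⟪dirDeriv s f y, η₀⟫ • dirDeriv s f y - ⟪k, η₀⟫ • k
  have smg : ContDiffOn ℝ ∞ g U :=
    (((contDiffOn_const.sub ((smN.inner ℝ contDiffOn_const).smul smN)).sub
      ((smW.inner ℝ contDiffOn_const).smul smW)).sub
      ((smS.inner ℝ contDiffOn_const).smul smS)).sub contDiffOn_const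
  have g0 : g y₀ ≠ 0 := by
    have e0 := hη₀' 0
    have e1 := hη₀' 1
    have e2 := hη₀' 2
    have e3 := hη₀' 3
    simp only [Matrix.cons_val] at e0 e1 e2 e3
    simp only [g, e0, e1, e2, e3]
    intro h
    simp at h
    simp [h] at hη₀
  have gperp : ∀ y ∈ U, ⟪N y, g y⟫ = 0 ∧ ⟪W y, g y⟫ = 0 ∧ ⟪dirDeriv s f y, g y⟫ = 0 ∧
      ⟪k, g y⟫ = 0 := by
    intro y hy
    have NS : ⟪N y, dirDeriv s f y⟫ = 0 := Nf y hy (s y)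
    obtain ⟨h1, h2, h3, h4, h5⟩ := hframe y hy
    simp only [g, inner_sub_right, inner_smul_right, NS, NW y hy, real_inner_comm k, kN,
      WW y hy, WS y hy, h2, kW y hy, h5, hk, real_inner_comm (N y) (W y),
      real_inner_comm (N y) (dirDeriv s f y), real_inner_comm (W y) (dirDeriv s f y)]
    have NN : ⟪N y, N y⟫ = 1 := hN y hy
    rw [NN]
    refine ⟨?_, ?_, ?_, ?_⟩ <;> ring
  refine ⟨U ∩ g ⁻¹' {0}ᶜ, Set.inter_subset_left, ⟨hy₀, g0⟩, t, s, N, W, dirDeriv s f,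
    fun y => ‖g y‖⁻¹ • g y, ?_⟩
  have hη : ∀ y x, ⟪x, g y⟫ = 0 → ⟪x, ‖g y‖⁻¹ • g y⟫ = 0 := fun y x h => by
    rw [inner_smul_right, h, mul_zero]
  have sub : U ∩ g ⁻¹' {0}ᶜ ⊆ U := Set.inter_subset_left
  refine
    { isOpen := smg.continuousOn.isOpen_inter_preimage hU isOpen_compl_singleton
      f_smooth := hf.mono sub
      t_smooth := smt.mono sub
      s_smooth := sms.mono sub
      W_smooth := smW.mono sub
      S_smooth := smS.mono sub
      η_smooth := (smg.mono sub).normalize fun y hy => hy.2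
      N_eq := fun y hy => rfl
      df_t := fun y hy => ?_
      df_s := fun y hy => rfl
      range_le := fun y hy => ?_
      NN := fun y hy => hN y hy.1
      WW := fun y hy => WW y hy.1
      SS := fun y hy => (hframe y hy.1).2.1
      ηη := fun y hy => inner_normalize_self hy.2
      kk := hk
      NW := fun y hy => NW y hy.1
      NS := fun y hy => Nf y hy.1 (s y)
      Nη := fun y hy => hη _ _ (gperp y hy.1).1
      WS := fun y hy => WS y hy.1
      Wη := fun y hy => hη _ _ (gperp y hy.1).2.1
      Sη := fun y hy => hη _ _ (gperp y hy.1).2.2.1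
      kN := fun y hy => kN y
      kW := fun y hy => kW y hy.1
      kS := fun y hy => (hframe y hy.1).2.2.2.2
      kη := fun y hy => hη _ _ (gperp y hy.1).2.2.2
      expand := fun y hy => ?_ }
  · simp [W, dirDeriv, smul_smul, mul_inv_cancel₀ hc]
  · obtain ⟨h1, h2, h3, -⟩ := hframe y hy.1
    exact exists_eq_add_smul_of_orthonormal_map hV (fderiv ℝ f y) h1 h2 h3
  · have on : Orthonormal ℝ ![N y, W y, dirDeriv s f y, ‖g y‖⁻¹ • g y, k] := by
      have n1 : ∀ x : E, ⟪x, x⟫ = 1 → ‖x‖ = 1 := fun x hx => by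
        rw [norm_eq_sqrt_real_inner, hx, Real.sqrt_one]
      obtain ⟨g1, g2, g3, g4⟩ := gperp y hy.1
      obtain ⟨-, h2, -, -, h5⟩ := hframe y hy.1
      have NS : ⟪N y, dirDeriv s f y⟫ = 0 := Nf y hy.1 (s y)
      simp only [orthonormal_vecCons_iff, Fin.forall_fin_succ, Fin.forall_fin_zero,
        Matrix.cons_val_zero, Matrix.cons_val_succ, n1 _ (WW y hy.1), n1 _ h2,
        n1 _ (inner_normalize_self hy.2), n1 _ hk, NW y hy.1, NS, hη _ _ g1, hη _ _ g2, hη _ _ g3,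
        WS y hy.1, real_inner_comm k, kN, kW y hy.1, h5, hη _ _ g4, true_and, and_true]
      exact ⟨n1 _ (hN y hy.1), by simp [Orthonormal]⟩
    intro x
    have := on.sum_inner_smul_of_card_eq_finrank (by simp [hE]) x
    simp only [Fin.sum_univ_five, Matrix.cons_val] at this
    exact this.symm

theorem eq_zero_of_isParallelMeanCurvature {U : Set V} (hU : IsOpen U) {f : V → E}
    (hf : ContDiffOn ℝ ∞ f U) (hinj : ∀ y ∈ U, Function.Injective (fderiv ℝ f y))
    (hV : Module.finrank ℝ V = 2) (hE : Module.finrank ℝ E = 5) {k : E} (hk : ⟪k, k⟫ = 1)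
    (hN : ∀ y ∈ U, ⟪f y - ⟪k, f y⟫ • k, f y - ⟪k, f y⟫ • k⟫ = 1) {σ c : ℝ}
    (hσ : 0 < σ) (hc : 0 < c) (hσc : σ ^ 2 + c ^ 2 = 1)
    (hangle : ∀ y ∈ U, ∃ v, ⟪fderiv ℝ f y v, fderiv ℝ f y v⟫ = 1 ∧
      ∀ u, ⟪fderiv ℝ f y u, k⟫ = σ * ⟪fderiv ℝ f y u, fderiv ℝ f y v⟫)
    {H : V → E} (hH : IsParallelMeanCurvature f k H U) {y : V} (hy : y ∈ U) : H y = 0 := by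
  obtain ⟨U', hU', hyU', t, s, N, W, S, η, h⟩ := exists_isAdaptedFrame hU hf hinj hV hE hk hN
    hσ.ne' hc.ne' hσc hangle hy
  exact h.eq_zero_of_isParallelMeanCurvature hσ hc hσc (hH.mono hU') y hyU'

end Frame

/-! ### Derivatives in the preferred charts -/

section Chart
variable {M : Type*} [TopologicalSpace M] [ChartedSpace (EuclideanSpace ℝ (Fin 2)) M]

/-- The derivative at `q` of the preferred chart at `p`. -/
noncomputable def chartDeriv (p q : M) : EuclideanSpace ℝ (Fin 2) →L[ℝ] EuclideanSpace ℝ (Fin 2) :=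
  mfderiv (𝓡 2) 𝓘(ℝ, EuclideanSpace ℝ (Fin 2)) (extChartAt (𝓡 2) p) q

/-- The change of charts from the preferred chart at `q` to the one at `p`. -/
noncomputable def chartChange (p q : M) (x : EuclideanSpace ℝ (Fin 2)) :
    EuclideanSpace ℝ (Fin 2) :=
  extChartAt (𝓡 2) p ((extChartAt (𝓡 2) q).symm x)

theorem chartChange_apply (p q : M) :
    chartChange p q (extChartAt (𝓡 2) q q) = extChartAt (𝓡 2) p q := by
  simp [chartChange]

theorem eventually_symm_eq_symm_chartChange {p q : M} (hq : q ∈ (extChartAt (𝓡 2) p).source) :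
    ∀ᶠ x in nhds (extChartAt (𝓡 2) q q),
      (extChartAt (𝓡 2) q).symm x = (extChartAt (𝓡 2) p).symm (chartChange p q x) := by
  have h := (continuousAt_extChartAt_symm (I := 𝓡 2) q).preimage_mem_nhds
    (t := (extChartAt (𝓡 2) p).source)
    (by rw [extChartAt_to_inv]; exact extChartAt_source_mem_nhds' hq)
  filter_upwards [h] with x hx
  exact ((extChartAt (𝓡 2) p).left_inv hx).symm

variable [IsManifold (𝓡 2) ∞ M]

theorem mdifferentiableAt_extChartAt_of_mem {p q : M} (hq : q ∈ (extChartAt (𝓡 2) p).source) :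
    MDifferentiableAt (𝓡 2) 𝓘(ℝ, EuclideanSpace ℝ (Fin 2)) (extChartAt (𝓡 2) p) q := by
  have : IsManifold (𝓡 2) 1 M := IsManifold.of_le (n := ∞) ENat.LEInfty.out
  exact mdifferentiableAt_extChartAt (by rwa [extChartAt_source] at hq)

theorem chartDeriv_bijective {p q : M} (hq : q ∈ (extChartAt (𝓡 2) p).source) :
    Function.Bijective (chartDeriv p q) := by
  have : IsManifold (𝓡 2) 1 M := IsManifold.of_le (n := ∞) ENat.LEInfty.out
  exact (isInvertible_mfderiv_extChartAt hq).bijective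

/-- The tangent space at q is identified with the model by the preferred chart at q itself. -/
theorem chartDeriv_self (q : M) : chartDeriv q q = ContinuousLinearMap.id ℝ _ := by
  have h := (mdifferentiableAt_extChartAt_of_mem (mem_extChartAt_source (I := 𝓡 2) q))
  have h' := h.mfderiv
  rw [ModelWithCorners.range_eq_univ, fderivWithin_univ] at h'
  refine Eq.trans h' ?_
  have : writtenInExtChartAt (𝓡 2) 𝓘(ℝ, EuclideanSpace ℝ (Fin 2)) q (extChartAt (𝓡 2) q)
      =ᶠ[nhds (extChartAt (𝓡 2) q q)] id := by
    filter_upwards [extChartAt_target_mem_nhds (I := 𝓡 2) q] with x hx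
    exact (extChartAt (𝓡 2) q).right_inv hx
  exact this.fderiv_eq.trans fderiv_id

theorem fderiv_chartChange {p q : M} (hq : q ∈ (extChartAt (𝓡 2) p).source) :
    fderiv ℝ (chartChange p q) (extChartAt (𝓡 2) q q) = chartDeriv p q := by
  have h := mdifferentiableAt_extChartAt_of_mem hq
  have h' := h.mfderiv
  rw [ModelWithCorners.range_eq_univ, fderivWithin_univ] at h'
  exact h'.symm

theorem contDiffAt_chartChange {p q : M} (hq : q ∈ (extChartAt (𝓡 2) p).source) :
    ContDiffAt ℝ ∞ (chartChange p q) (extChartAt (𝓡 2) q q) := by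
  rw [← contMDiffAt_iff_contDiffAt]
  have h1 : ContMDiffAt 𝓘(ℝ, EuclideanSpace ℝ (Fin 2)) (𝓡 2) ∞ (extChartAt (𝓡 2) q).symm
      (extChartAt (𝓡 2) q q) :=
    (contMDiffOn_extChartAt_symm q).contMDiffAt (extChartAt_target_mem_nhds q)
  have h2 : ContMDiffAt (𝓡 2) 𝓘(ℝ, EuclideanSpace ℝ (Fin 2)) ∞ (extChartAt (𝓡 2) p)
      ((extChartAt (𝓡 2) q).symm (extChartAt (𝓡 2) q q)) := by
    rw [extChartAt_to_inv]
    exact contMDiffAt_extChartAt' (by rwa [extChartAt_source] at hq)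
  exact h2.comp _ h1

theorem diff_eq_fderiv_chartDeriv {p q : M} (hq : q ∈ (extChartAt (𝓡 2) p).source)
    {g : M → S3R.E5} {g' : EuclideanSpace ℝ (Fin 2) → S3R.E5}
    (hg : ∀ᶠ x in nhds (extChartAt (𝓡 2) p q), g ((extChartAt (𝓡 2) p).symm x) = g' x)
    (h : DifferentiableAt ℝ g' (extChartAt (𝓡 2) p q)) :
    S3R.diff g q = (fderiv ℝ g' (extChartAt (𝓡 2) p q)).comp (chartDeriv p q) := by
  have h1 := h.hasFDerivAt.hasMFDerivAt.comp q
    (mdifferentiableAt_extChartAt_of_mem hq).hasMFDerivAt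
  have h2 : g =ᶠ[nhds q] g' ∘ extChartAt (𝓡 2) p := by
    filter_upwards [(continuousAt_extChartAt' hq).eventually hg,
      extChartAt_source_mem_nhds' hq] with x hx hx'
    rw [(extChartAt (𝓡 2) p).left_inv hx'] at hx
    exact hx
  exact (h1.congr_of_eventuallyEq h2).mfderiv

end Chart

/-! ### Metric trace and second-order chain rule -/

section Trace
variable {E : Type*} [NormedAddCommGroup E] [InnerProductSpace ℝ E]

/-- If P has columns t and s, orthonormality says Pᵀ G P = 1, so G⁻¹ = P Pᵀ and the contraction
becomes the sum over t, s. -/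
theorem sum_gram_inv_mul_eq (L : EuclideanSpace ℝ (Fin 2) →L[ℝ] E)
    (B : EuclideanSpace ℝ (Fin 2) →ₗ[ℝ] EuclideanSpace ℝ (Fin 2) →ₗ[ℝ] ℝ)
    {t s : EuclideanSpace ℝ (Fin 2)} (h1 : ⟪L t, L t⟫ = 1) (h2 : ⟪L s, L s⟫ = 1)
    (h3 : ⟪L t, L s⟫ = 0) :
    ∑ i : Fin 2, ∑ j : Fin 2, (Matrix.of fun i j : Fin 2 =>
      ⟪L (EuclideanSpace.single i (1 : ℝ)), L (EuclideanSpace.single j (1 : ℝ))⟫)⁻¹ i j *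
      B (EuclideanSpace.single i (1 : ℝ)) (EuclideanSpace.single j (1 : ℝ)) = B t t + B s s := by
  have hx : ∀ x : EuclideanSpace ℝ (Fin 2), x = x 0 • EuclideanSpace.single 0 (1 : ℝ) +
      x 1 • EuclideanSpace.single 1 (1 : ℝ) := fun x => by
    ext i
    fin_cases i <;> simp
  have hL : ∀ x y : EuclideanSpace ℝ (Fin 2), ⟪L x, L y⟫ =
      x 0 * y 0 * ⟪L (EuclideanSpace.single 0 (1 : ℝ)), L (EuclideanSpace.single 0 (1 : ℝ))⟫ +
      x 0 * y 1 * ⟪L (EuclideanSpace.single 0 (1 : ℝ)), L (EuclideanSpace.single 1 (1 : ℝ))⟫ +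
      x 1 * y 0 * ⟪L (EuclideanSpace.single 1 (1 : ℝ)), L (EuclideanSpace.single 0 (1 : ℝ))⟫ +
      x 1 * y 1 * ⟪L (EuclideanSpace.single 1 (1 : ℝ)), L (EuclideanSpace.single 1 (1 : ℝ))⟫ := by
    intro x y
    conv_lhs => rw [hx x, hx y]
    simp only [map_add, map_smul, inner_add_left, inner_add_right, inner_smul_left,
      inner_smul_right, conj_trivial]
    ring
  set G : Matrix (Fin 2) (Fin 2) ℝ := Matrix.of fun i j : Fin 2 =>
      ⟪L (EuclideanSpace.single i (1 : ℝ)), L (EuclideanSpace.single j (1 : ℝ))⟫ with hG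
  let P : Matrix (Fin 2) (Fin 2) ℝ := !![t 0, s 0; t 1, s 1]
  have h4 : ⟪L s, L t⟫ = 0 := by rw [real_inner_comm, h3]
  rw [hL] at h1 h2 h3 h4
  have hP : P.transpose * G * P = 1 := by
    ext i j
    fin_cases i <;> fin_cases j <;>
      simp [P, hG, Matrix.mul_apply, Fin.sum_univ_two, -inner_self_eq_norm_sq_to_K] <;> linarith
  have hinv : G⁻¹ = P * P.transpose := by
    apply Matrix.inv_eq_left_inv
    rw [Matrix.mul_assoc, mul_eq_one_comm, hP]
  rw [hinv]
  conv_rhs => rw [hx t, hx s]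
  simp [P, Matrix.mul_apply, Fin.sum_univ_two]
  ring

end Trace

theorem Submodule.inner_starProjection_of_mem {E : Type*} [NormedAddCommGroup E]
    [InnerProductSpace ℝ E] (K : Submodule ℝ E) [K.HasOrthogonalProjection] {w : E} (hw : w ∈ K)
    (v : E) : ⟪w, K.starProjection v⟫ = ⟪w, v⟫ := by
  rw [← Submodule.inner_starProjection_left_eq_right, Submodule.starProjection_eq_self_iff.2 hw]

theorem fderiv_fderiv_comp_apply {V V' G : Type*} [NormedAddCommGroup V] [NormedSpace ℝ V]
    [NormedAddCommGroup V'] [NormedSpace ℝ V'] [NormedAddCommGroup G] [NormedSpace ℝ G]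
    {f : V' → G} {τ : V → V'} {x : V} (hf : ContDiffAt ℝ ∞ f (τ x)) (hτ : ContDiffAt ℝ ∞ τ x)
    (u v : V) : fderiv ℝ (fderiv ℝ (f ∘ τ)) x u v =
      fderiv ℝ (fderiv ℝ f) (τ x) (fderiv ℝ τ x u) (fderiv ℝ τ x v) +
        fderiv ℝ f (τ x) (fderiv ℝ (fderiv ℝ τ) x u v) := by
  have hf' : ∀ᶠ y in nhds (τ x), DifferentiableAt ℝ f y :=
    ((hf.of_le (m := 1) ENat.LEInfty.out).eventually (by simp)).mono
      fun y hy => hy.differentiableAt (by simp)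
  have hτ' : ∀ᶠ y in nhds x, DifferentiableAt ℝ τ y :=
    ((hτ.of_le (m := 1) ENat.LEInfty.out).eventually (by simp)).mono
      fun y hy => hy.differentiableAt (by simp)
  have h : fderiv ℝ (f ∘ τ) =ᶠ[nhds x] fun y => (fderiv ℝ f (τ y)).comp (fderiv ℝ τ y) := by
    filter_upwards [hτ.continuousAt.eventually hf', hτ'] with y h1 h2
    exact fderiv_comp y h1 h2
  have d1 : DifferentiableAt ℝ (fderiv ℝ f) (τ x) :=
    (hf.fderiv_right (m := 1) (by rw [one_add_one_eq_two]; exact ENat.LEInfty.out)).differentiableAt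
      (by simp)
  have d2 : DifferentiableAt ℝ (fderiv ℝ τ) x :=
    (hτ.fderiv_right (m := 1) (by rw [one_add_one_eq_two]; exact ENat.LEInfty.out)).differentiableAt
      (by simp)
  have d3 : HasFDerivAt (fun y => fderiv ℝ f (τ y)) _ x :=
    d1.hasFDerivAt.comp x (hτ.differentiableAt (by simp)).hasFDerivAt
  rw [h.fderiv_eq, (d3.clm_comp d2.hasFDerivAt).fderiv]
  simp [add_comm]

theorem DifferentiableAt.clm_apply_const {V V' G : Type*} [NormedAddCommGroup V]
    [NormedSpace ℝ V] [NormedAddCommGroup V'] [NormedSpace ℝ V'] [NormedAddCommGroup G]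
    [NormedSpace ℝ G] {g : V → V' →L[ℝ] G} {x : V} (h : DifferentiableAt ℝ g x) (v : V') :
    DifferentiableAt ℝ (fun z => g z v) x ∧
      ∀ u, fderiv ℝ (fun z => g z v) x u = fderiv ℝ g x u v := by
  have d := h.hasFDerivAt.clm_apply (hasFDerivAt_const (𝕜 := ℝ) v x)
  exact ⟨d.differentiableAt, fun u => by simp [d.fderiv]⟩

/-! ### From the immersed surface to a local parametrization -/

namespace S3R

theorem finrank_E5 : Module.finrank ℝ E5 = 5 := by
  rw [(WithLp.linearEquiv 2 ℝ (EuclideanSpace ℝ (Fin 4) × ℝ)).finrank_eq]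
  simp

theorem inner_dt_dt : ⟪dt, dt⟫ = 1 := by
  simp [dt]

theorem incl_sub_inner_smul (q : Space) : incl q - ⟪dt, incl q⟫ • dt =
    WithLp.toLp 2 ((q.1 : EuclideanSpace ℝ (Fin 4)), (0 : ℝ)) := by
  have : ⟪dt, incl q⟫ = q.2 := by simp [dt, incl, WithLp.prod_inner_apply]
  rw [this]
  apply WithLp.ofLp_injective
  ext1 <;> simp [dt, incl]

theorem inner_incl_sub_inner_smul_self (q : Space) :
    ⟪incl q - ⟪dt, incl q⟫ • dt, incl q - ⟪dt, incl q⟫ • dt⟫ = 1 := by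
  rw [incl_sub_inner_smul, WithLp.prod_inner_apply]
  simp

theorem mem_ambientTangent_iff (q : Space) (w : E5) :
    w ∈ ambientTangent q ↔ ⟪incl q - ⟪dt, incl q⟫ • dt, w⟫ = 0 := by
  rw [incl_sub_inner_smul, ambientTangent, Submodule.mem_orthogonal_singleton_iff_inner_right]

theorem contMDiff_coe_sphere_three : ContMDiff (𝓡 3) 𝓘(ℝ, EuclideanSpace ℝ (Fin 4)) ∞
    ((↑) : sphere (0 : EuclideanSpace ℝ (Fin 4)) 1 → EuclideanSpace ℝ (Fin 4)) :=
  have : Fact (Module.finrank ℝ (EuclideanSpace ℝ (Fin 4)) = 3 + 1) := ⟨by simp⟩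
  contMDiff_coe_sphere

theorem mfderiv_coe_sphere_three_injective (v : sphere (0 : EuclideanSpace ℝ (Fin 4)) 1) :
    Function.Injective (mfderiv (𝓡 3) 𝓘(ℝ, EuclideanSpace ℝ (Fin 4))
      ((↑) : sphere (0 : EuclideanSpace ℝ (Fin 4)) 1 → EuclideanSpace ℝ (Fin 4)) v) := by
  have : Fact (Module.finrank ℝ (EuclideanSpace ℝ (Fin 4)) = 3 + 1) := ⟨by simp⟩
  have h := injective_mvfderiv_subtypeVal_sphere (n := 3) v
  rw [((contMDiff_coe_sphere_three v).mdifferentiableAt (by simp)).mvfderiv] at h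
  rw [((contMDiff_coe_sphere_three v).mdifferentiableAt (by simp)).mfderiv]
  exact h

variable {M : Type*} [TopologicalSpace M] [ChartedSpace (EuclideanSpace ℝ (Fin 2)) M]

/-- The local parametrization of the surface given by the preferred chart at `p`. -/
noncomputable def localParam (F : M → Space) (p : M) (x : EuclideanSpace ℝ (Fin 2)) : E5 :=
  incl (F ((extChartAt (𝓡 2) p).symm x))

theorem localParam_extChartAt (F : M → Space) {p q : M} (hq : q ∈ (extChartAt (𝓡 2) p).source) :
    localParam F p (extChartAt (𝓡 2) p q) = incl (F q) := by
  rw [localParam, (extChartAt (𝓡 2) p).left_inv hq]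

theorem IsSmoothImmersion.contMDiff_incl {F : M → Space} (hF : IsSmoothImmersion F) :
    ContMDiff (𝓡 2) 𝓘(ℝ, E5) ∞ (fun q => incl (F q)) := by
  have h1 : ContMDiff (𝓡 2) 𝓘(ℝ, EuclideanSpace ℝ (Fin 4)) ∞
      (fun q => ((F q).1 : EuclideanSpace ℝ (Fin 4))) :=
    contMDiff_coe_sphere_three.comp (contMDiff_fst.comp hF.contMDiff)
  have h2 : ContMDiff (𝓡 2) 𝓘(ℝ, ℝ) ∞ (fun q => (F q).2) := contMDiff_snd.comp hF.contMDiff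
  let e := (WithLp.prodContinuousLinearEquiv 2 ℝ (EuclideanSpace ℝ (Fin 4)) ℝ).symm
  exact e.contDiff.contMDiff.comp (h1.prodMk_space h2)

theorem IsSmoothImmersion.diff_injective {F : M → Space} (hF : IsSmoothImmersion F) (q : M) :
    Function.Injective (diff (fun q => incl (F q)) q) := by
  rw [injective_iff_map_eq_zero]
  intro u hu
  have hFd : MDifferentiableAt (𝓡 2) ((𝓡 3).prod 𝓘(ℝ, ℝ)) F q :=
    (hF.contMDiff q).mdifferentiableAt (by simp)
  have hG : MDifferentiableAt (𝓡 2) 𝓘(ℝ, E5) (fun q => incl (F q)) q :=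
    (hF.contMDiff_incl q).mdifferentiableAt (by simp)
  have hL : ∀ {G : Type} [NormedAddCommGroup G] [NormedSpace ℝ G] (L : E5 →L[ℝ] G),
      mfderiv (𝓡 2) 𝓘(ℝ, G) (L ∘ fun q => incl (F q)) q u = 0 := by
    intro G _ _ L
    have := L.hasMFDerivAt.comp q hG.hasMFDerivAt
    rw [this.mfderiv]
    change L (diff (fun q => incl (F q)) q u) = 0
    rw [hu, map_zero]
  let e := (WithLp.prodContinuousLinearEquiv 2 ℝ
    (EuclideanSpace ℝ (Fin 4)) ℝ).toContinuousLinearMap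
  have h1 := hL ((ContinuousLinearMap.fst ℝ _ _).comp e)
  have h2 := hL ((ContinuousLinearMap.snd ℝ _ _).comp e)
  have hc : MDifferentiableAt (𝓡 3) 𝓘(ℝ, EuclideanSpace ℝ (Fin 4))
      ((↑) : sphere (0 : EuclideanSpace ℝ (Fin 4)) 1 → EuclideanSpace ℝ (Fin 4)) (F q).1 :=
    (contMDiff_coe_sphere_three _).mdifferentiableAt (by simp)
  have h3 := hc.hasMFDerivAt.comp q ((hasMFDerivAt_fst (F q)).comp q hFd.hasMFDerivAt)
  have h4 := (hasMFDerivAt_snd (I := 𝓡 3) (I' := 𝓘(ℝ, ℝ)) (F q)).comp q hFd.hasMFDerivAt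
  have h5 := (congrArg (fun A => A u) h3.mfderiv).symm.trans h1
  have h6 := (congrArg (fun A => A u) h4.mfderiv).symm.trans h2
  have h7 := mfderiv_coe_sphere_three_injective (F q).1 (h5.trans (map_zero _).symm)
  refine hF.injective_mfderiv q (Eq.trans ?_ (map_zero _).symm)
  exact Prod.ext h7 h6

theorem meanCurvature_mem_normalPlane (F : M → Space) (q : M) :
    meanCurvature F q ∈ normalPlane F q :=
  Submodule.smul_mem _ _ (Submodule.sum_mem _ fun _ _ => Submodule.sum_mem _ fun _ _ =>
    Submodule.smul_mem _ _ (Submodule.starProjection_apply_mem _ _))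

variable [IsManifold (𝓡 2) ∞ M]

theorem IsSmoothImmersion.contDiffOn_localParam {F : M → Space} (hF : IsSmoothImmersion F)
    (p : M) : ContDiffOn ℝ ∞ (localParam F p) (extChartAt (𝓡 2) p).target := by
  rw [← contMDiffOn_iff_contDiffOn]
  exact hF.contMDiff_incl.comp_contMDiffOn (contMDiffOn_extChartAt_symm p)

theorem IsSmoothImmersion.contDiffAt_localParam {F : M → Space} (hF : IsSmoothImmersion F)
    {p q : M} (hq : q ∈ (extChartAt (𝓡 2) p).source) :
    ContDiffAt ℝ ∞ (localParam F p) (extChartAt (𝓡 2) p q) :=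
  (hF.contDiffOn_localParam p).contDiffAt
    ((isOpen_extChartAt_target p).mem_nhds ((extChartAt (𝓡 2) p).map_source hq))

theorem IsSmoothImmersion.diff_incl {F : M → Space} (hF : IsSmoothImmersion F)
    {p q : M} (hq : q ∈ (extChartAt (𝓡 2) p).source) (u : EuclideanSpace ℝ (Fin 2)) :
    diff (fun q => incl (F q)) q u =
      fderiv ℝ (localParam F p) (extChartAt (𝓡 2) p q) (chartDeriv p q u) := by
  rw [diff_eq_fderiv_chartDeriv hq (g' := localParam F p) (Filter.Eventually.of_forall fun _ => rfl)
    ((hF.contDiffAt_localParam hq).differentiableAt (by simp))]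
  rfl

theorem IsSmoothImmersion.isSurfaceNormal_iff {F : M → Space} (hF : IsSmoothImmersion F)
    {p q : M} (hq : q ∈ (extChartAt (𝓡 2) p).source) (w : E5) :
    IsSurfaceNormal (localParam F p) dt (extChartAt (𝓡 2) p q) w ↔ w ∈ normalPlane F q := by
  rw [IsSurfaceNormal, normalPlane, Submodule.mem_inf, localParam_extChartAt F hq,
    mem_ambientTangent_iff, Submodule.mem_orthogonal]
  refine and_congr_right fun _ => ⟨?_, ?_⟩
  · rintro h _ ⟨u, rfl⟩
    exact (congrArg (fun x => ⟪x, w⟫) (hF.diff_incl hq u)).trans (h _)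
  · intro h v
    obtain ⟨u, rfl⟩ := (chartDeriv_bijective hq).2 v
    rw [← hF.diff_incl hq]
    exact h _ ⟨u, rfl⟩

/-- The form at q is defined in the chart at q, while the local argument uses one chart at p. Under
the change of charts, the second derivative acquires an extra term in the image of the differential,
which is orthogonal to w. -/
theorem IsSmoothImmersion.inner_secondFundamentalForm {F : M → Space} (hF : IsSmoothImmersion F)
    {p q : M} (hq : q ∈ (extChartAt (𝓡 2) p).source) {w : E5} (hw : w ∈ normalPlane F q)
    (u v : EuclideanSpace ℝ (Fin 2)) : ⟪w, secondFundamentalForm F q u v⟫ =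
      ⟪w, fderiv ℝ (fderiv ℝ (localParam F p)) (extChartAt (𝓡 2) p q)
        (chartDeriv p q u) (chartDeriv p q v)⟫ := by
  have hqq := mem_extChartAt_source (I := 𝓡 2) q
  have hfq := hF.contDiffAt_localParam hqq
  have dfq : DifferentiableAt ℝ (fderiv ℝ (localParam F q)) (extChartAt (𝓡 2) q q) :=
    (hfq.fderiv_right (m := 1) (by rw [one_add_one_eq_two]; exact ENat.LEInfty.out)).differentiableAt
      (by simp)
  obtain ⟨d, d'⟩ := dfq.clm_apply_const v
  have h1 : diff (coordField F q v) q u =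
      fderiv ℝ (fderiv ℝ (localParam F q)) (extChartAt (𝓡 2) q q) u v := by
    rw [diff_eq_fderiv_chartDeriv hqq (g' := fun x => fderiv ℝ (localParam F q) x v) ?_
      d, chartDeriv_self]
    · exact d' u
    · filter_upwards [extChartAt_target_mem_nhds (I := 𝓡 2) q] with x hx
      rw [coordField, (extChartAt (𝓡 2) q).right_inv hx]
      rfl
  have h2 : localParam F q =ᶠ[nhds (extChartAt (𝓡 2) q q)] localParam F p ∘ chartChange p q := by
    filter_upwards [eventually_symm_eq_symm_chartChange hq] with x hx
    rw [Function.comp_apply, localParam, hx, localParam]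
  have hfp := hF.contDiffAt_localParam hq
  rw [← chartChange_apply p q] at hfp
  rw [secondFundamentalForm, Submodule.inner_starProjection_of_mem _ hw, ambientCov,
    Submodule.inner_starProjection_of_mem _ (Submodule.mem_inf.1 hw).1, h1, h2.fderiv.fderiv_eq,
    fderiv_fderiv_comp_apply hfp (contDiffAt_chartChange hq), inner_add_right,
    fderiv_chartChange hq, chartChange_apply, real_inner_comm (fderiv ℝ (localParam F p) _ _),
    ((hF.isSurfaceNormal_iff hq w).2 hw).2, add_zero]

theorem IsSmoothImmersion.two_mul_inner_meanCurvature {F : M → Space} (hF : IsSmoothImmersion F)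
    {p q : M} (hq : q ∈ (extChartAt (𝓡 2) p).source) {w : E5} (hw : w ∈ normalPlane F q)
    {t s : EuclideanSpace ℝ (Fin 2)} {f : EuclideanSpace ℝ (Fin 2) → E5}
    {y : EuclideanSpace ℝ (Fin 2)} (hf : f = localParam F p) (hy : y = extChartAt (𝓡 2) p q)
    (h1 : ⟪fderiv ℝ f y t, fderiv ℝ f y t⟫ = 1) (h2 : ⟪fderiv ℝ f y s, fderiv ℝ f y s⟫ = 1)
    (h3 : ⟪fderiv ℝ f y t, fderiv ℝ f y s⟫ = 0) :
    2 * ⟪w, meanCurvature F q⟫ =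
      ⟪w, fderiv ℝ (fderiv ℝ f) y t t⟫ + ⟪w, fderiv ℝ (fderiv ℝ f) y s s⟫ := by
  obtain ⟨t, rfl⟩ := (chartDeriv_bijective hq).2 t
  obtain ⟨s, rfl⟩ := (chartDeriv_bijective hq).2 s
  subst hf hy
  simp only [← hF.diff_incl hq] at h1 h2 h3
  let B : EuclideanSpace ℝ (Fin 2) →ₗ[ℝ] EuclideanSpace ℝ (Fin 2) →ₗ[ℝ] ℝ :=
    LinearMap.mk₂ ℝ (fun u v => ⟪w, fderiv ℝ (fderiv ℝ (localParam F p)) (extChartAt (𝓡 2) p q)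
        (chartDeriv p q u) (chartDeriv p q v)⟫)
      (fun u u' v => by simp [inner_add_right]) (fun r u v => by simp [inner_smul_right])
      (fun u v v' => by simp [inner_add_right]) (fun r u v => by simp [inner_smul_right])
  have := sum_gram_inv_mul_eq (diff (fun q => incl (F q)) q) B h1 h2 h3
  refine Eq.trans ?_ this
  rw [meanCurvature, inner_smul_right, inner_sum, ← mul_assoc, mul_one_div_cancel two_ne_zero,
    one_mul]
  refine Finset.sum_congr rfl fun i _ => ?_
  rw [inner_sum]
  refine Finset.sum_congr rfl fun j _ => ?_
  rw [inner_smul_right, hF.inner_secondFundamentalForm hq hw]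
  rfl

/-- Both projections in the normal connection disappear when paired with a normal vector, so the
condition involves only the Euclidean derivative of H. -/
theorem IsSmoothImmersion.isParallelMeanCurvature {F : M → Space} (hF : IsSmoothImmersion F)
    (hH : HasParallelMeanCurvature F) (p : M) :
    IsParallelMeanCurvature (localParam F p) dt
      (fun x => meanCurvature F ((extChartAt (𝓡 2) p).symm x)) (extChartAt (𝓡 2) p).target := by
  have key : ∀ q ∈ (extChartAt (𝓡 2) p).source,
      DifferentiableAt ℝ (fun x => meanCurvature F ((extChartAt (𝓡 2) p).symm x))
        (extChartAt (𝓡 2) p q) → ∀ w ∈ normalPlane F q, ∀ u,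
      ⟪w, fderiv ℝ (fun x => meanCurvature F ((extChartAt (𝓡 2) p).symm x))
        (extChartAt (𝓡 2) p q) u⟫ = 0 := by
    intro q hq hd w hw u
    obtain ⟨u, rfl⟩ := (chartDeriv_bijective hq).2 u
    have h := congrArg (fun v => ⟪w, v⟫) (hH q u)
    simp only [normalCov, ambientCov] at h
    rwa [Submodule.inner_starProjection_of_mem _ hw,
      Submodule.inner_starProjection_of_mem _ (Submodule.mem_inf.1 hw).1,
      diff_eq_fderiv_chartDeriv hq (Filter.Eventually.of_forall fun _ => rfl) hd,
      inner_zero_right] at h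
  refine ⟨fun y hy => ?_, fun y hy w hw t s h1 h2 h3 => ?_, fun y hy hd w hw u => ?_⟩ <;>
    have hq := (extChartAt (𝓡 2) p).map_target hy <;>
    have hy' := (extChartAt (𝓡 2) p).right_inv hy
  · have := (hF.isSurfaceNormal_iff hq _).2 (meanCurvature_mem_normalPlane F _)
    rwa [hy'] at this
  · rw [← hy', hF.isSurfaceNormal_iff hq] at hw
    exact hF.two_mul_inner_meanCurvature hq hw rfl hy'.symm h1 h2 h3
  · rw [← hy', hF.isSurfaceNormal_iff hq] at hw
    have := key _ hq (by rwa [hy']) w hw u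
    rwa [hy'] at this

end S3R

/-! ### Conclusion -/

theorem theorem1 {M : Type*} [TopologicalSpace M] [ChartedSpace (EuclideanSpace ℝ (Fin 2)) M]
    [IsManifold (𝓡 2) ∞ M] (F : M → S3R.Space) (hF : S3R.IsSmoothImmersion F)
    (θ : ℝ) (hθ0 : 0 < θ) (hθ1 : θ < Real.pi / 2)
    (hangle : ∀ p : M, S3R.HasAngleAt F θ p)
    (hH : S3R.HasParallelMeanCurvature F) :
    ∀ p : M, S3R.meanCurvature F p = 0 := by
  intro p
  have hp := mem_extChartAt_source (I := 𝓡 2) p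
  have h := eq_zero_of_isParallelMeanCurvature (isOpen_extChartAt_target p)
    (hF.contDiffOn_localParam p) ?_ (by simp) S3R.finrank_E5 S3R.inner_dt_dt
    (fun y _ => S3R.inner_incl_sub_inner_smul_self _)
    (Real.sin_pos_of_pos_of_lt_pi hθ0 (by linarith [Real.pi_pos]))
    (Real.cos_pos_of_mem_Ioo ⟨by linarith, hθ1⟩) (Real.sin_sq_add_cos_sq θ) ?_
    (hF.isParallelMeanCurvature hH p) ((extChartAt (𝓡 2) p).map_source hp)
  · simpa using h
  · intro y hy u v huv
    have hq := (extChartAt (𝓡 2) p).map_target hy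
    obtain ⟨u, rfl⟩ := (chartDeriv_bijective hq).2 u
    obtain ⟨v, rfl⟩ := (chartDeriv_bijective hq).2 v
    have hdiff := hF.diff_incl hq
    rw [(extChartAt (𝓡 2) p).right_inv hy] at hdiff
    rw [← hdiff, ← hdiff] at huv
    rw [hF.diff_injective _ huv]
  · intro y hy
    have hq := (extChartAt (𝓡 2) p).map_target hy
    have hy' := (extChartAt (𝓡 2) p).right_inv hy
    obtain ⟨T, ⟨u, rfl⟩, ξ, hξ, hT, -, hdt⟩ := hangle ((extChartAt (𝓡 2) p).symm y)
    have hu := hF.diff_incl hq u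
    rw [hy'] at hu
    have hξ' := (hF.isSurfaceNormal_iff hq ξ).2 hξ
    rw [hy'] at hξ'
    -- The coordinate vector of T; pairing tangent vectors with `dt` removes the ξ-part and leaves
    -- sin θ times the product with T.
    refine ⟨chartDeriv p ((extChartAt (𝓡 2) p).symm y) u, ?_, fun v => ?_⟩
    · rw [← hu, real_inner_self_eq_norm_sq]
      exact (congrArg (· ^ 2) hT).trans (one_pow 2)
    · rw [← hu, hdt, inner_add_right, inner_smul_right, inner_smul_right, hξ'.2, mul_zero, add_zero]
      rfl
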